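/- **Conventions.** For a Borel probability measure $m$ on a metric space put $M_m(r)=\inf_{x\in\operatorname{supp} m} m(B(x,r))$, and $$\overline{\dim}_M(m)=\limsup_{r\to0}\frac{\log M_m(r)}{\log r},\qquad \underline{\dim}_M(m)=\liminf_{r\to0}\frac{\log M_m(r)}{\log r}$$ (values in $[-\infty,\infty]$); write $\dim_M(m)$ when they coincide. *Semiflow.* Let $(f_t)_{t\ge0}$ be a semiflow of Borel maps of a metric space $\mathcal X$ ($f_0=\mathrm{id}$, $f_{s+t}=f_s\circ f_t$) preserving an ergodic Borel probability measure $\nu$. Let $\Omega$ be its non-wandering set: $x\in\Omega$ if for every open $U\ni x$ and every $T\ge 0$ there is $t\ge T$ with $f_t(U)\cap U\ne\emptyset$. The cover time of $x$ at scale $r$ is $$\tau_r(x)=\inf\{T>0:\ \forall y\in\Omega\ \exists t\le T:\ d(f_t(x),y)<r\}\in[0,\infty].$$ *Poincaré section.* Let $Y\subset\mathcal X$ and $R_Y(x)=\inf\{t>0: f_t(x)\in Y\}$. Assume that for every $y\in Y$ this infimum is over a nonempty set, is positive and is attained, and let $F(y)=f_{R_Y(y)}(y)$, $F:Y\to Y$.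 Let $\mu$ be the probability measure on $Y$ induced by $\nu$, i.e. $\overline R:=\int_Y R_Y\,d\mu<\infty$ and $$\int g\,d\nu=\frac1{\overline R}\int_Y\int_0^{R_Y(y)}g(f_t(y))\,dt\,d\mu(y)$$ for all bounded measurable $g:\mathcal X\to\mathbb R$. *Gibbs–Markov.* A piecewise expanding Markov map is given by a finite or countable family $\{P_a\}_{a\in\mathcal A}$ of nondegenerate intervals in $[0,1]$ with disjoint interiors and a map $g:\bigcup_aP_a\to[0,1]$ such that each $g|_{P_a}$ is continuous and injective, $g(P_a)\cap\bigcup_bP_b$ is a union of elements of the family, and, for some $\gamma>1$ independent of $a$, $g$ is differentiable with $|g'|\ge\gamma$ on the interior of each $P_a$. Its repeller $\Lambda$ is the set of points all of whose iterates stay in $\bigcup_aP_a$. Write $a\to b$ if $P_b\subseteq g(P_a)$; $g$ is topologically transitive if any two symbols are joined by a finite path of such transitions. Let $\Sigma\subset\mathcal A^{\mathbb N_0}$ be the one-sided shift space of these transitions, with left shift $\sigma$ and the metric $2^{-\min\{j:\,x_j\ne y_j\}}$. The system $(Y,F,\mu)$ is Gibbs–Markov if there are such a topologically transitive $g$, a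 bi-Lipschitz bijection $\iota:Y\to\Lambda$ with $\iota\circ F=g\circ\iota$, and a $\sigma$-invariant Borel probability measure $\tilde\mu$ on $\Sigma$ with $\mu=\pi_*\tilde\mu$ for a measurable $\pi:\Sigma\to Y$ satisfying $\iota(F^k(\pi\omega))\in P_{\omega_k}$ for all $k\ge 0$, for $\tilde\mu$-a.e. $\omega$, such that for some locally Hölder $\phi:\Sigma\to\mathbb R$ (Hölder on pairs of words with the same first letter), $G>0$ and $p\in\mathbb R$, $$\frac1G\le\frac{\tilde\mu([\omega_0,\dots,\omega_{n-1}])}{\exp\big(\sum_{j=0}^{n-1}\phi(\sigma^j\omega)-np\big)}\le G\qquad(\omega\in\Sigma,\ n\ge1).$$ An interval of $Y$ is a set $\iota^{-1}(J)$ with $J\subset\mathbb R$ an interval. **Theorem.** In this setting assume * (H1) $\dim_M(\mu)$ exists and is finite; * (H2) $(Y,F,\mu)$ is Gibbs–Markov, in a coordinate $\iota$; * (H3) there is $K>0$ with $d(f_s(x),f_{s+t}(x))<Kt$ for all $x\in\mathcal X$, $s\ge0$, $t>0$; * (H4) $(f_t)$ is topologically mixing (for all nonempty open $U,V$ there is $T$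 with $f_t(U)\cap V\neq\emptyset$ for all $t\ge T$), and there is $T_1>0$ with $\bigcup_{0<t\le T_1}f_t(Y)=\mathcal X$; * (H5) $C_f:=\sup\{\operatorname{diam} f_t(I)/\operatorname{diam} I:\ I \text{ an interval of } Y,\ \operatorname{diam} I>0,\ 0<t\le T_1\}\in(0,\infty)$, for this $T_1$ and this $\iota$. Then for $\nu$-almost every $x$, $$\liminf_{r\to0}\frac{\log\tau_r(x)}{-\log r}\ \ge\ \underline{\dim}_M(\nu)-1 .$$ If moreover $\overline{\dim}_M(\nu)=\dim_M(\mu)+1$, then for $\nu$-almost every $x$, $$\limsup_{r\to0}\frac{\log\tau_r(x)}{-\log r}\ \le\ \dim_M(\mu).$$ -/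

import Mathlib

open MeasureTheory Filter Topology
open scoped NNReal ENNReal

noncomputable section

namespace CoverTime

/-! ### Minkowski dimensions of a measure -/

/-- `M_μ(r)`: the smallest measure of a ball of radius `r` centred in the support of `μ`. -/
def minBall {X : Type*} [PseudoMetricSpace X] [MeasurableSpace X] (μ : Measure X) (r : ℝ) : ℝ≥0∞ :=
  ⨅ x ∈ μ.support, μ (Metric.ball x r)

/-- Upper Minkowski dimension, `limsup_{r → 0} log M_μ(r) / log r`, with values in `[-∞, ∞]`. -/
def upperMinkowskiDim {X : Type*} [PseudoMetricSpace X] [MeasurableSpace X] (μ : Measure X) :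
    EReal :=
  limsup (fun r : ℝ => ENNReal.log (minBall μ r) / ((Real.log r : ℝ) : EReal)) (𝓝[>] 0)

/-- Lower Minkowski dimension, `liminf_{r → 0} log M_μ(r) / log r`, with values in `[-∞, ∞]`. -/
def lowerMinkowskiDim {X : Type*} [PseudoMetricSpace X] [MeasurableSpace X] (μ : Measure X) :
    EReal :=
  liminf (fun r : ℝ => ENNReal.log (minBall μ r) / ((Real.log r : ℝ) : EReal)) (𝓝[>] 0)

/-! ### Semiflows and cover times -/

/-- A family of self-maps indexed by `t ≥ 0` that forms a semiflow (a flow in forward time).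
Continuity in the space variable is not required. -/
structure IsSemiflow {X : Type*} (f : ℝ≥0 → X → X) : Prop where
  zero : ∀ x, f 0 x = x
  add : ∀ s t x, f (s + t) x = f s (f t x)

/-- Ergodicity: every measurable set that is invariant under all time maps is null or conull. -/
def IsErgodicFlow {X : Type*} [MeasurableSpace X] (f : ℝ≥0 → X → X) (ν : Measure X) : Prop :=
  ∀ B : Set X, MeasurableSet B → (∀ t, f t ⁻¹' B = B) → ν B = 0 ∨ ν Bᶜ = 0

/-- The non-wandering set: every neighbourhood of the point meets its own images at arbitrarily
large times. -/
def nonwanderingSet {X : Type*} [TopologicalSpace X] (f : ℝ≥0 → X → X) : Set X :=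
  {x | ∀ U : Set X, IsOpen U → x ∈ U → ∀ T : ℝ≥0, ∃ t, T ≤ t ∧ (f t '' U ∩ U).Nonempty}

/-- The cover time of the non-wandering set at scale `r` by the orbit of `x` (it is `∞` if the
orbit never covers at that scale). -/
def flowCoverTime {X : Type*} [PseudoMetricSpace X] (f : ℝ≥0 → X → X) (r : ℝ) (x : X) : ℝ≥0∞ :=
  ⨅ (T : ℝ≥0) (_ : 0 < T ∧ ∀ y ∈ nonwanderingSet f, ∃ t ≤ T, dist (f t x) y < r), (T : ℝ≥0∞)

/-- Topological mixing of a semiflow. -/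
def IsTopologicallyMixing {X : Type*} [TopologicalSpace X] (f : ℝ≥0 → X → X) : Prop :=
  ∀ U V : Set X, IsOpen U → IsOpen V → U.Nonempty → V.Nonempty →
    ∃ T : ℝ≥0, ∀ t, T ≤ t → (f t '' U ∩ V).Nonempty

/-- Bounded speed. -/
def HasBoundedSpeed {X : Type*} [PseudoMetricSpace X] (f : ℝ≥0 → X → X) : Prop :=
  ∃ K : ℝ, 0 < K ∧ ∀ (x : X) (s t : ℝ≥0), 0 < t → dist (f s x) (f (s + t) x) < K * t

/-! ### Poincaré sections -/

/-- The first hitting time `R_Y(x) = inf {t > 0 : f_t(x) ∈ Y}`. -/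
def hittingTime {X : Type*} (f : ℝ≥0 → X → X) (Y : Set X) (x : X) : ℝ≥0 :=
  sInf {t : ℝ≥0 | 0 < t ∧ f t x ∈ Y}

/-- Every point of the section returns to it, and there is a first positive return time. -/
def IsPoincareSection {X : Type*} (f : ℝ≥0 → X → X) (Y : Set X) : Prop :=
  ∀ y ∈ Y, 0 < hittingTime f Y y ∧ f (hittingTime f Y y) y ∈ Y

/-- The Poincaré map `F = f_{R_Y}` on the section. -/
def poincareMap {X : Type*} (f : ℝ≥0 → X → X) (Y : Set X) (hY : IsPoincareSection f Y) (y : Y) : Y :=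
  ⟨f (hittingTime f Y y) y, (hY y y.2).2⟩

/-- `μ` is the measure on the section `Y` induced by the flow-invariant probability measure `ν`:
the mean return time `R = ∫ R_Y dμ` is finite and
`∫ g dν = R⁻¹ ∫_Y ∫_0^{R_Y(y)} g(f_t(y)) dt dμ(y)`, stated for indicators of measurable sets. -/
structure IsInducedMeasure {X : Type*} [MeasurableSpace X] (f : ℝ≥0 → X → X) (ν : Measure X)
    (Y : Set X) (μ : Measure Y) : Prop where
  integrable : Integrable (fun y : Y => (hittingTime f Y y : ℝ)) μ
  decomposition : ∀ B : Set X, MeasurableSet B →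
    ENNReal.ofReal (∫ y : Y, (hittingTime f Y y : ℝ) ∂μ) * ν B =
      ∫⁻ y : Y, (∫⁻ t in Set.Ico (0 : ℝ) (hittingTime f Y y),
        B.indicator (fun _ => (1 : ℝ≥0∞)) (f t.toNNReal y)) ∂μ

/-! ### Gibbs–Markov maps -/

/-- A piecewise expanding Markov map: `P` is a family of nondegenerate subintervals of `[0,1]` with
disjoint interiors, `g` maps their union into `[0,1]`, and on every `P a` it is continuous,
injective, expanding by a uniform factor, and the image of `P a` is (inside the union of all the
intervals) a union of elements of the family. Only the values of `g` on the union matter. -/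
structure IsExpandingMarkov {A : Type*} (P : A → Set ℝ) (g : ℝ → ℝ) : Prop where
  ordConnected : ∀ a, (P a).OrdConnected
  subset_unit : ∀ a, P a ⊆ Set.Icc 0 1
  nondegenerate : ∀ a, (interior (P a)).Nonempty
  disjoint_interior : Pairwise fun a b => Disjoint (interior (P a)) (interior (P b))
  mapsTo : ∀ a, Set.MapsTo g (P a) (Set.Icc 0 1)
  continuousOn : ∀ a, ContinuousOn g (P a)
  injOn : ∀ a, Set.InjOn g (P a)
  markov : ∀ a, ∃ S : Set A, g '' P a ∩ (⋃ b, P b) = ⋃ b ∈ S, P b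
  expanding : ∃ γ : ℝ, 1 < γ ∧ ∀ a, ∀ x ∈ interior (P a), DifferentiableAt ℝ g x ∧ γ ≤ |deriv g x|

/-- The repeller: the points all of whose iterates lie in the union of the intervals. -/
def repeller {A : Type*} (P : A → Set ℝ) (g : ℝ → ℝ) : Set ℝ :=
  {x | ∀ k : ℕ, g^[k] x ∈ ⋃ a, P a}

/-- The transition `a → b` is allowed: `P b` is one of the elements that make up the image of
`P a`. (Intersections at common endpoints only do not count.) -/
def Transition {A : Type*} (P : A → Set ℝ) (g : ℝ → ℝ) (a b : A) : Prop := P b ⊆ g '' P a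

/-- The one-sided shift space of infinite admissible words. -/
abbrev ShiftSpace {A : Type*} (P : A → Set ℝ) (g : ℝ → ℝ) : Type _ :=
  {ω : ℕ → A // ∀ k, Transition P g (ω k) (ω (k + 1))}

/-- The left shift. -/
def shift {A : Type*} (P : A → Set ℝ) (g : ℝ → ℝ) (ω : ShiftSpace P g) : ShiftSpace P g :=
  ⟨fun k => ω.1 (k + 1), fun k => ω.2 (k + 1)⟩

/-- The `n`-cylinder of words that agree with `ω` in the first `n` letters. -/
def cylinder {A : Type*} (P : A → Set ℝ) (g : ℝ → ℝ) (ω : ShiftSpace P g) (n : ℕ) :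
    Set (ShiftSpace P g) :=
  {η | ∀ j < n, η.1 j = ω.1 j}

/-- Local Hölder continuity for the metric `2^{-n}`, `n` the first index of disagreement. -/
def IsLocallyHolder {A : Type*} (P : A → Set ℝ) (g : ℝ → ℝ) (φ : ShiftSpace P g → ℝ) : Prop :=
  ∃ C α : ℝ, 0 < α ∧ ∀ n : ℕ, 1 ≤ n → ∀ ω, ∀ η ∈ cylinder P g ω n,
    |φ η - φ ω| ≤ C * (2 : ℝ) ^ (-(α * n))

/-- The Gibbs property of a measure on the shift space, for the potential `φ`. -/
def IsGibbs {A : Type*} [MeasurableSpace A] (P : A → Set ℝ) (g : ℝ → ℝ) (m : Measure (ShiftSpace P g))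
    (φ : ShiftSpace P g → ℝ) : Prop :=
  ∃ G p : ℝ, 0 < G ∧ ∀ n : ℕ, 1 ≤ n → ∀ ω : ShiftSpace P g,
    1 / G ≤ m.real (cylinder P g ω n) /
        Real.exp (∑ j ∈ Finset.range n, φ ((shift P g)^[j] ω) - n * p) ∧
      m.real (cylinder P g ω n) /
        Real.exp (∑ j ∈ Finset.range n, φ ((shift P g)^[j] ω) - n * p) ≤ G

/-- `(Y, F, μ)` is Gibbs–Markov in the coordinate `ι : Y → ℝ`. The coordinate is bi-Lipschitz and
identifies `F` with the restriction to its repeller of a topologically transitive piecewise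
expanding Markov map, and `μ` is the projection under the coding map of a shift-invariant
probability measure on the shift space that has the Gibbs property for a locally Hölder
potential. -/
structure IsGibbsMarkov {Y : Type*} [PseudoMetricSpace Y] [MeasurableSpace Y] (F : Y → Y)
    (μ : Measure Y) {A : Type*} [MeasurableSpace A] (P : A → Set ℝ) (g : ℝ → ℝ) (ι : Y → ℝ) :
    Prop where
  expandingMarkov : IsExpandingMarkov P g
  transitive : ∀ a b, Relation.TransGen (Transition P g) a b
  biLipschitz : ∃ L : ℝ≥0, LipschitzWith L ι ∧ AntilipschitzWith L ι
  range_eq : Set.range ι = repeller P g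
  conj : ∀ y, ι (F y) = g (ι y)
  gibbs : ∃ m : Measure (ShiftSpace P g), IsProbabilityMeasure m ∧
    MeasurePreserving (shift P g) m m ∧
    (∃ π : ShiftSpace P g → Y, MeasurePreserving π m μ ∧
      ∀ᵐ ω ∂m, ∀ k : ℕ, ι (F^[k] (π ω)) ∈ P (ω.1 k)) ∧
    ∃ φ : ShiftSpace P g → ℝ, IsLocallyHolder P g φ ∧ IsGibbs P g m φ

/-- The distortion constant `sup diam f_t(I) / diam I` over `0 < t ≤ T₁` and over the intervals
`I` of the section, i.e. the sets `ι ⁻¹' J` with `J` an interval of the line, `ι` being the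
coordinate on the section. Degenerate intervals contribute `0 / 0 = 0`. -/
def distortion {X : Type*} [PseudoMetricSpace X] (f : ℝ≥0 → X → X) (Y : Set X) (ι : Y → ℝ)
    (T₁ : ℝ≥0) : ℝ≥0∞ :=
  ⨆ (J : Set ℝ) (_ : J.OrdConnected) (t : ℝ≥0) (_ : 0 < t ∧ t ≤ T₁),
    Metric.ediam ((fun y : Y => f t y) '' (ι ⁻¹' J)) / Metric.ediam (ι ⁻¹' J)

end CoverTime

end

/-! Lower bound. Take z whose ball of radius r has mass less than r^α. Bounded speed turns a visit
to a ball of radius ρ into a visit to the doubled ball at a time on the grid of step ρ/K, so by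
invariance z is approached before time T with probability at most (TK/ρ + 2) ν(B(z, 2ρ))
(`measureReal_flowCoverTime_lt_le`). The factor 1/ρ is the loss of one in the exponent. For T =
2^(bn) and b + 1 < α these bounds are summable along ρ ~ 2^(-n), and Borel–Cantelli concludes.

Upper bound. The Gibbs property makes cylinder masses multiplicative up to constants. With
transitivity, any two words can then be joined through one of finitely many connecting words, even
over an infinite alphabet (`IsQuasiBernoulli.exists_joining`). Each block of time thus gives the
orbit a fresh chance, proportional to its mass, of hitting a target, and avoidance decays
exponentially (`IsQuasiBernoulli.exists_avoid_le`). Itineraries of length O(n) resolve points to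
2^(-n). For β above the upper dimension of μ, a net of at most 2^(βn) balls of mass at least 2^(-βn)
is all hit within 2^(bn) steps, b > β, by a union bound (`IsGibbsMarkov.ae_orbit_dense`).

The elapsed flow time is a sum of integrable return times, controlled by Markov's inequality. Every
point of X is f_t z with z in Y and t ≤ T₁, and bounded distortion makes these f_t uniformly
Lipschitz on Y, so density in Y passes to X (`ae_section_orbit_dense`). Finally, ν-typical points
lie on arcs leading to μ-typical points of Y. -/

noncomputable section

namespace CoverTime

/-! ### Shift spaces with a quasi-Bernoulli measure -/

section Symbolic

variable {A : Type*} {P : A → Set ℝ} {g : ℝ → ℝ}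

theorem iterate_shift_apply (ω : ShiftSpace P g) (n k : ℕ) :
    ((shift P g)^[n] ω).1 k = ω.1 (k + n) := by
  induction n generalizing ω with
  | zero => rfl
  | succ n ih => rw [Function.iterate_succ_apply, ih, shift]; congr 1

theorem mem_cylinder_self (ω : ShiftSpace P g) (n : ℕ) : ω ∈ cylinder P g ω n := fun _ _ => rfl

theorem cylinder_eq_of_mem {ω η : ShiftSpace P g} {n : ℕ} (h : η ∈ cylinder P g ω n) :
    cylinder P g η n = cylinder P g ω n := by
  ext ζ
  exact forall₂_congr fun j hj => by rw [h j hj]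

/-- A union of `n`-cylinders. -/
def IsSaturated (n : ℕ) (U : Set (ShiftSpace P g)) : Prop :=
  ∀ ω ∈ U, cylinder P g ω n ⊆ U

/-- The word of the first `n` letters. -/
def firstLetters (n : ℕ) (ω : ShiftSpace P g) : Fin n → A := fun j => ω.1 j

theorem cylinder_eq_preimage (ω : ShiftSpace P g) (n : ℕ) :
    cylinder P g ω n = firstLetters n ⁻¹' {firstLetters n ω} := by
  ext η
  simp only [Set.mem_preimage, Set.mem_singleton_iff, funext_iff]
  exact ⟨fun h j => h j j.2, fun h j hj => h ⟨j, hj⟩⟩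

theorem IsSaturated.eq_biUnion {n : ℕ} {U : Set (ShiftSpace P g)} (hU : IsSaturated n U) :
    U = ⋃ w ∈ firstLetters n '' U,
      firstLetters n ⁻¹' {w} := by
  ext ω
  simp only [Set.mem_iUnion, Set.mem_preimage, Set.mem_singleton_iff, exists_prop]
  refine ⟨fun h => ⟨_, Set.mem_image_of_mem _ h, rfl⟩, ?_⟩
  rintro ⟨w, ⟨η, hη, rfl⟩, h⟩
  refine hU η hη ?_
  rw [cylinder_eq_preimage]
  exact h

/-- The first `n` letters followed by the sequence `η`. -/
def concat (ω η : ShiftSpace P g) (n : ℕ) (h : Transition P g (ω.1 n) (η.1 0)) :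
    ShiftSpace P g :=
  -- The letters with indices 0 to n are kept, n + 1 of them, so that `ω.1 n` is the last one before
  -- the junction.
  ⟨fun k => if k < n + 1 then ω.1 k else η.1 (k - (n + 1)), fun k => by
    beta_reduce
    rcases lt_trichotomy k n with hk | rfl | hk
    · rw [if_pos (by omega), if_pos (by omega)]
      exact ω.2 k
    · rw [if_pos (by omega), if_neg (by omega)]
      simpa using h
    · rw [if_neg (by omega), if_neg (by omega), show k + 1 - (n + 1) = k - (n + 1) + 1 by omega]
      exact η.2 _⟩

theorem concat_apply_lt {ω η : ShiftSpace P g} {n : ℕ} (h : Transition P g (ω.1 n) (η.1 0))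
    {k : ℕ} (hk : k < n + 1) : (concat ω η n h).1 k = ω.1 k := if_pos hk

theorem concat_apply_add {ω η : ShiftSpace P g} {n : ℕ} (h : Transition P g (ω.1 n) (η.1 0))
    (k : ℕ) : (concat ω η n h).1 (k + (n + 1)) = η.1 k := by
  change (if k + (n + 1) < n + 1 then _ else _) = _
  rw [if_neg (by omega), Nat.add_sub_cancel]

theorem iterate_shift_concat {ω η : ShiftSpace P g} {n : ℕ}
    (h : Transition P g (ω.1 n) (η.1 0)) : (shift P g)^[n + 1] (concat ω η n h) = η := by
  ext k
  rw [iterate_shift_apply, concat_apply_add]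

theorem cylinder_concat {ω η : ShiftSpace P g} {n : ℕ} (h : Transition P g (ω.1 n) (η.1 0)) :
    cylinder P g (concat ω η n h) (n + 1) = cylinder P g ω (n + 1) :=
  cylinder_eq_of_mem fun _ hj => concat_apply_lt h hj

/-- A path from a letter to itself gives it a successor; iterating a choice of successors produces
the sequence. -/
theorem exists_sequence_start (htr : ∀ a b, Relation.TransGen (Transition P g) a b) (a : A) :
    ∃ ω : ShiftSpace P g, ω.1 0 = a := by
  have hs : ∀ a : A, ∃ b, Transition P g a b := fun a => by
    rcases Relation.TransGen.head'_iff.1 (htr a a) with ⟨b, hb, -⟩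
    exact ⟨b, hb⟩
  choose s hs using hs
  refine ⟨⟨fun k => s^[k] a, fun k => ?_⟩, rfl⟩
  beta_reduce
  rw [Function.iterate_succ_apply']
  exact hs _

theorem exists_sequence_through (htr : ∀ a b, Relation.TransGen (Transition P g) a b) (a b : A) :
    ∃ (ω : ShiftSpace P g) (l : ℕ), ω.1 0 = a ∧ ω.1 l = b := by
  refine Relation.TransGen.head_induction_on
    (motive := fun c _ => ∃ (ω : ShiftSpace P g) (l : ℕ), ω.1 0 = c ∧ ω.1 l = b) (htr a b) ?_ ?_
  · intro c hc
    obtain ⟨η, hη⟩ := exists_sequence_start htr b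
    obtain ⟨ω, hω⟩ := exists_sequence_start htr c
    have h : Transition P g (ω.1 0) (η.1 0) := by rwa [hω, hη]
    refine ⟨concat ω η 0 h, 1, ?_, ?_⟩
    · rw [concat_apply_lt h (by omega), hω]
    · rw [← hη]; exact concat_apply_add h 0
  · rintro c d hcd - ⟨η, l, hη, hl⟩
    obtain ⟨ω, hω⟩ := exists_sequence_start htr c
    have h : Transition P g (ω.1 0) (η.1 0) := by rwa [hω, hη]
    refine ⟨concat ω η 0 h, l + 1, ?_, ?_⟩
    · rw [concat_apply_lt h (by omega), hω]
    · rw [← hl]; exact concat_apply_add h l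

variable [MeasurableSpace A]

/-- Cylinders have positive measure, and the measure of a concatenation of words is comparable to
the product of the measures. -/
structure IsQuasiBernoulli (m : Measure (ShiftSpace P g)) (Q : ℝ) : Prop where
  pos : ∀ (ω : ShiftSpace P g) (n : ℕ), 1 ≤ n → 0 < m.real (cylinder P g ω n)
  upper : ∀ (ω : ShiftSpace P g) (n k : ℕ), 1 ≤ n → 1 ≤ k →
    m.real (cylinder P g ω (n + k)) ≤
      Q * m.real (cylinder P g ω n) * m.real (cylinder P g ((shift P g)^[n] ω) k)
  lower : ∀ (ω : ShiftSpace P g) (n k : ℕ), 1 ≤ n → 1 ≤ k →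
    m.real (cylinder P g ω n) * m.real (cylinder P g ((shift P g)^[n] ω) k) ≤
      Q * m.real (cylinder P g ω (n + k))

/-- Birkhoff sums are additive along orbits, so the Gibbs weights are exactly multiplicative.
Passing between masses and weights costs a factor `G` for each of the three cylinders. -/
theorem IsGibbs.exists_isQuasiBernoulli {m : Measure (ShiftSpace P g)} {φ : ShiftSpace P g → ℝ}
    (h : IsGibbs P g m φ) : ∃ Q : ℝ, 0 < Q ∧ IsQuasiBernoulli m Q := by
  obtain ⟨G, p, hG, h⟩ := h
  set E : ShiftSpace P g → ℕ → ℝ := fun ω n =>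
    Real.exp (∑ j ∈ Finset.range n, φ ((shift P g)^[j] ω) - n * p) with hE
  have hEpos : ∀ ω n, 0 < E ω n := fun _ _ => Real.exp_pos _
  have hmul : ∀ ω n k, E ω (n + k) = E ω n * E ((shift P g)^[n] ω) k := by
    intro ω n k
    simp only [hE]
    rw [← Real.exp_add, Finset.sum_range_add]
    congr 1
    have : ∀ x, (shift P g)^[n + x] ω = (shift P g)^[x] ((shift P g)^[n] ω) := fun x => by
      rw [add_comm, Function.iterate_add_apply]
    simp only [this]
    push_cast
    ring
  have hup : ∀ ω n, 1 ≤ n → m.real (cylinder P g ω n) ≤ G * E ω n := fun ω n hn =>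
    (div_le_iff₀ (hEpos ω n)).1 (h n hn ω).2
  have hlo : ∀ ω n, 1 ≤ n → E ω n ≤ G * m.real (cylinder P g ω n) := fun ω n hn => by
    have := (le_div_iff₀ (hEpos ω n)).1 (h n hn ω).1
    rwa [one_div, inv_mul_le_iff₀ hG] at this
  refine ⟨G ^ 3, by positivity, fun ω n hn => ?_, fun ω n k hn hk => ?_, fun ω n k hn hk => ?_⟩
  · have := (hEpos ω n).trans_le (hlo ω n hn)
    exact pos_of_mul_pos_right this hG.le
  · calc m.real (cylinder P g ω (n + k)) ≤ G * (E ω n * E ((shift P g)^[n] ω) k) := by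
          rw [← hmul]; exact hup _ _ (by omega)
      _ ≤ G * ((G * m.real (cylinder P g ω n)) *
            (G * m.real (cylinder P g ((shift P g)^[n] ω) k))) := by
          gcongr
          · exact hlo _ _ hn
          · exact hlo _ _ hk
      _ = _ := by ring
  · calc _ ≤ (G * E ω n) * (G * E ((shift P g)^[n] ω) k) := by
          gcongr
          · exact hup _ _ hn
          · exact hup _ _ hk
      _ = G ^ 2 * E ω (n + k) := by rw [hmul]; ring
      _ ≤ G ^ 2 * (G * m.real (cylinder P g ω (n + k))) := by
          gcongr
          exact hlo _ _ (by omega)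
      _ = _ := by ring

theorem measurable_shift : Measurable (shift P g) := by
  refine Measurable.subtype_mk (measurable_pi_lambda _ fun k => ?_)
  exact (measurable_pi_apply (k + 1)).comp measurable_subtype_coe

theorem measurable_firstLetters (n : ℕ) :
    Measurable (firstLetters n : ShiftSpace P g → Fin n → A) :=
  measurable_pi_lambda _ fun j => (measurable_pi_apply (j : ℕ)).comp measurable_subtype_coe

variable [Countable A] [DiscreteMeasurableSpace A]

theorem measurableSet_cylinder (ω : ShiftSpace P g) (n : ℕ) :
    MeasurableSet (cylinder P g ω n) := by
  rw [cylinder_eq_preimage]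
  exact measurable_firstLetters n (MeasurableSet.singleton _)

theorem IsSaturated.measurableSet {n : ℕ} {U : Set (ShiftSpace P g)} (hU : IsSaturated n U) :
    MeasurableSet U := by
  rw [hU.eq_biUnion]
  exact MeasurableSet.biUnion (Set.to_countable _) fun w _ =>
    measurable_firstLetters n (MeasurableSet.singleton w)

/-- An inequality between measures of `n`-cylinders extends to unions of `n`-cylinders. -/
theorem measure_le_of_forall_cylinder {ρ₁ ρ₂ : Measure (ShiftSpace P g)} {n : ℕ}
    (h : ∀ ω, ρ₁ (cylinder P g ω n) ≤ ρ₂ (cylinder P g ω n)) {U : Set (ShiftSpace P g)}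
    (hU : IsSaturated n U) : ρ₁ U ≤ ρ₂ U := by
  -- Over a countable alphabet a saturated set is a countable disjoint union of cylinders, so both
  -- measures are sums over words.
  have key : ∀ ρ : Measure (ShiftSpace P g), ρ U =
      ∑' w : (firstLetters n '' U : Set (Fin n → A)),
        ρ (firstLetters n ⁻¹' {(w : Fin n → A)}) := by
    intro ρ
    conv_lhs => rw [hU.eq_biUnion]
    refine measure_biUnion (Set.to_countable _) ?_ fun w _ =>
      measurable_firstLetters n (MeasurableSet.singleton w)
    intro v _ w _ hvw
    exact Disjoint.preimage _ (Set.disjoint_singleton.2 hvw)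
  rw [key, key]
  refine ENNReal.tsum_le_tsum ?_
  rintro ⟨w, ω, -, rfl⟩
  simpa only [← cylinder_eq_preimage] using h ω

end Symbolic

/-! ### Quasi-independence, joining of words and avoidance probabilities -/

section Mixing

variable {A : Type*} {P : A → Set ℝ} {g : ℝ → ℝ}

theorem cylinder_inter_preimage_shift {ω η ζ : ShiftSpace P g} {n k : ℕ}
    (h₁ : ζ ∈ cylinder P g ω n) (h₂ : (shift P g)^[n] ζ ∈ cylinder P g η k) :
    cylinder P g ω n ∩ (shift P g)^[n] ⁻¹' cylinder P g η k = cylinder P g ζ (n + k) := by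
  rw [← cylinder_eq_of_mem h₁, ← cylinder_eq_of_mem h₂]
  ext ξ
  constructor
  · rintro ⟨h, h'⟩ j hj
    rcases lt_or_ge j n with hjn | hjn
    · exact h j hjn
    · have := h' (j - n) (by omega)
      rwa [iterate_shift_apply, iterate_shift_apply, Nat.sub_add_cancel hjn] at this
  · refine fun h => ⟨fun j hj => h j (by omega), fun j hj => ?_⟩
    rw [iterate_shift_apply, iterate_shift_apply]
    exact h _ (by omega)

variable [MeasurableSpace A] [Countable A] [DiscreteMeasurableSpace A]
  {m : Measure (ShiftSpace P g)} [IsProbabilityMeasure m] {Q : ℝ}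

omit [Countable A] [DiscreteMeasurableSpace A] in
theorem measurable_iterate_shift (n : ℕ) : Measurable ((shift P g)^[n]) :=
  measurable_shift.iterate n

/-- For two cylinders the intersection is empty or a single longer cylinder, and the upper bound
applies. Comparison of measures then extends the estimate to saturated `V` with a cylinder fixed,
and next to saturated `U` with `V` fixed. -/
theorem IsQuasiBernoulli.measure_inter_preimage_le (h : IsQuasiBernoulli m Q) (hQ : 0 < Q)
    {n k : ℕ} (hn : 1 ≤ n) (hk : 1 ≤ k) {U V : Set (ShiftSpace P g)} (hU : IsSaturated n U)
    (hV : IsSaturated k V) :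
    m (U ∩ (shift P g)^[n] ⁻¹' V) ≤ ENNReal.ofReal Q * m U * m V := by
  have hcyl : ∀ ω η : ShiftSpace P g,
      m (cylinder P g ω n ∩ (shift P g)^[n] ⁻¹' cylinder P g η k) ≤
        ENNReal.ofReal Q * m (cylinder P g ω n) * m (cylinder P g η k) := by
    intro ω η
    rcases (cylinder P g ω n ∩ (shift P g)^[n] ⁻¹' cylinder P g η k).eq_empty_or_nonempty with
      he | ⟨ζ, h₁, h₂⟩
    · simp [he]
    · rw [cylinder_inter_preimage_shift h₁ h₂, ← cylinder_eq_of_mem h₁, ← cylinder_eq_of_mem h₂,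
        ← ofReal_measureReal, ← ofReal_measureReal (μ := m) (s := cylinder P g ζ n),
        ← ofReal_measureReal (μ := m) (s := cylinder P g _ k), ← ENNReal.ofReal_mul hQ.le,
        ← ENNReal.ofReal_mul (by positivity)]
      exact ENNReal.ofReal_le_ofReal (h.upper ζ n k hn hk)
  have h₁ : ∀ ω : ShiftSpace P g, m (cylinder P g ω n ∩ (shift P g)^[n] ⁻¹' V) ≤
      ENNReal.ofReal Q * m (cylinder P g ω n) * m V := by
    intro ω
    have := measure_le_of_forall_cylinder
      (ρ₁ := (m.restrict (cylinder P g ω n)).map ((shift P g)^[n]))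
      (ρ₂ := (ENNReal.ofReal Q * m (cylinder P g ω n)) • m) (n := k) (fun η => by
        rw [Measure.map_apply (measurable_iterate_shift n) (measurableSet_cylinder _ _),
          Measure.restrict_apply (measurable_iterate_shift n (measurableSet_cylinder _ _)),
          Set.inter_comm]
        exact hcyl ω η) hV
    rwa [Measure.map_apply (measurable_iterate_shift n) hV.measurableSet,
      Measure.restrict_apply (measurable_iterate_shift n hV.measurableSet),
      Set.inter_comm] at this
  have h₂ := measure_le_of_forall_cylinder
    (ρ₁ := m.restrict ((shift P g)^[n] ⁻¹' V)) (ρ₂ := (ENNReal.ofReal Q * m V) • m) (n := n)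
    (fun ω => by
      rw [Measure.restrict_apply (measurableSet_cylinder _ _)]
      refine (h₁ ω).trans_eq ?_
      rw [Measure.smul_apply, smul_eq_mul]
      ring) hU
  rw [Measure.restrict_apply hU.measurableSet] at h₂
  refine h₂.trans_eq ?_
  rw [Measure.smul_apply, smul_eq_mul]
  ring

/-- The set of sequences whose first letter lies in `W`. -/
def startsIn (W : Set A) : Set (ShiftSpace P g) := {ω | ω.1 0 ∈ W}

omit [MeasurableSpace A] [Countable A] [DiscreteMeasurableSpace A] in
theorem isSaturated_startsIn (W : Set A) :
    IsSaturated 1 (startsIn W : Set (ShiftSpace P g)) := by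
  intro ω hω η hη
  have : η.1 0 = ω.1 0 := hη 0 one_pos
  change η.1 0 ∈ W
  rwa [this]

/-- Finitely many letters carry almost all the mass. -/
theorem exists_finset_measure_startsIn_compl_lt {ε : ℝ≥0∞} (hε : 0 < ε) :
    ∃ B : Finset A, m (startsIn (B : Set A)ᶜ) < ε := by
  set ρ : Measure A := m.map fun ω => ω.1 0 with hρ
  have hmeas : Measurable fun ω : ShiftSpace P g => ω.1 0 :=
    (measurable_pi_apply 0).comp measurable_subtype_coe
  have hfin : ∑' a, ρ {a} ≠ ⊤ := by
    have : IsProbabilityMeasure ρ := Measure.isProbabilityMeasure_map hmeas.aemeasurable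
    have h1 : ∑' a, ρ {a} = 1 := by
      rw [← measure_univ (μ := ρ), ← Set.iUnion_of_singleton A, measure_iUnion]
      · intro a b hab
        exact Set.disjoint_singleton.2 hab
      · exact fun a => MeasurableSet.singleton a
    simp [h1]
  have ht := ENNReal.tendsto_tsum_compl_atTop_zero hfin
  obtain ⟨B, hB⟩ := (ht.eventually (gt_mem_nhds hε)).exists
  refine ⟨B, lt_of_le_of_lt ?_ hB⟩
  have h2 : m (startsIn (B : Set A)ᶜ) = ρ (B : Set A)ᶜ := by
    rw [hρ, Measure.map_apply hmeas (MeasurableSet.of_discrete)]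
    rfl
  rw [h2]
  have h3 : (B : Set A)ᶜ = ⋃ b : {b // b ∉ B}, {(b : A)} := by
    ext a
    simp
  rw [h3]
  exact measure_iUnion_le _

/-- Big images and preimages: from every letter one can go to, and to every letter one can come
from, a fixed finite set of letters. -/
theorem IsQuasiBernoulli.exists_bigImages (h : IsQuasiBernoulli m Q) (hQ : 0 < Q)
    (hm : MeasurePreserving (shift P g) m m)
    (htr : ∀ a b, Relation.TransGen (Transition P g) a b) :
    ∃ B : Finset A, (∀ a, ∃ b ∈ B, Transition P g a b) ∧ ∀ b, ∃ a ∈ B, Transition P g a b := by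
  -- With less than 1/Q of the mass outside `B`, quasi-independence forbids that [a] be followed
  -- only by letters outside `B`: this would give m[a] ≤ Q m[a] m(Bᶜ) < m[a].
  obtain ⟨B, hB⟩ := exists_finset_measure_startsIn_compl_lt (m := m)
    (ε := (ENNReal.ofReal Q)⁻¹) (by simp)
  have hlt : ∀ a : A, ENNReal.ofReal Q * m (startsIn {a}) * m (startsIn (B : Set A)ᶜ) <
      m (startsIn {a}) := by
    intro a
    obtain ⟨ω, hω⟩ := exists_sequence_start htr a
    have hpos : m (startsIn {a}) ≠ 0 := by
      have hsub : cylinder P g ω 1 ⊆ startsIn {a} := isSaturated_startsIn {a} ω hω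
      have := h.pos ω 1 le_rfl
      rw [measureReal_def, ENNReal.toReal_pos_iff] at this
      exact (this.1.trans_le (measure_mono hsub)).ne'
    have hQ0 : ENNReal.ofReal Q ≠ 0 := by simpa using hQ
    calc _ = m (startsIn {a}) * (ENNReal.ofReal Q * m (startsIn (B : Set A)ᶜ)) := by ring
      _ < m (startsIn {a}) * 1 := by
        refine ENNReal.mul_lt_mul_right hpos (measure_ne_top _ _) ?_
        calc _ < ENNReal.ofReal Q * (ENNReal.ofReal Q)⁻¹ :=
              ENNReal.mul_lt_mul_right hQ0 ENNReal.ofReal_ne_top hB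
          _ = 1 := ENNReal.mul_inv_cancel hQ0 ENNReal.ofReal_ne_top
      _ = _ := mul_one _
  refine ⟨B, fun a => ?_, fun b => ?_⟩
  · by_contra! hcon
    have hsub : (startsIn {a} : Set (ShiftSpace P g)) ⊆
        startsIn {a} ∩ (shift P g)^[1] ⁻¹' startsIn (B : Set A)ᶜ := by
      intro ω hω
      refine ⟨hω, fun hb => hcon _ hb ?_⟩
      have := ω.2 0
      rwa [show ω.1 0 = a from hω] at this
    exact absurd ((measure_mono hsub).trans (h.measure_inter_preimage_le hQ le_rfl le_rfl
      (isSaturated_startsIn _) (isSaturated_startsIn _))) (not_le.2 (hlt a))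
  · by_contra! hcon
    -- For predecessors the same contradiction is obtained on the preimage of [b], which has the
    -- mass of [b] by invariance.
    have hsub : (shift P g) ⁻¹' startsIn {b} ⊆
        startsIn (B : Set A)ᶜ ∩ (shift P g)^[1] ⁻¹' startsIn {b} := by
      intro ω hω
      refine ⟨fun hb => hcon _ hb ?_, hω⟩
      have := ω.2 0
      rwa [show ω.1 (0 + 1) = b from hω] at this
    have h1 := (measure_mono hsub).trans (h.measure_inter_preimage_le hQ le_rfl le_rfl
      (isSaturated_startsIn _) (isSaturated_startsIn _))
    rw [hm.measure_preimage (isSaturated_startsIn _).measurableSet.nullMeasurableSet] at h1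
    refine absurd (h1.trans_eq ?_) (not_le.2 (hlt b))
    ring

omit [Countable A] [DiscreteMeasurableSpace A] [IsProbabilityMeasure m] in
theorem IsQuasiBernoulli.le_concat (h : IsQuasiBernoulli m Q) {ω η : ShiftSpace P g} {n k : ℕ}
    (hk : 1 ≤ k) (ht : Transition P g (ω.1 n) (η.1 0)) :
    m.real (cylinder P g ω (n + 1)) * m.real (cylinder P g η k) ≤
      Q * m.real (cylinder P g (concat ω η n ht) (n + 1 + k)) := by
  have := h.lower (concat ω η n ht) (n + 1) k (by omega) hk
  rwa [cylinder_concat, iterate_shift_concat] at this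

/-- Any two cylinders are joined, within a bounded gap, with at least the product measure up to a
constant. -/
theorem IsQuasiBernoulli.exists_joining (h : IsQuasiBernoulli m Q) (hQ : 0 < Q)
    (hm : MeasurePreserving (shift P g) m m)
    (htr : ∀ a b, Relation.TransGen (Transition P g) a b) :
    ∃ (L : ℕ) (c : ℝ), 0 < c ∧ ∀ (ω η : ShiftSpace P g) (n k : ℕ), 1 ≤ k →
      ∃ j ≤ L, c * m.real (cylinder P g ω (n + 1)) * m.real (cylinder P g η k) ≤
        m.real (cylinder P g ω (n + 1) ∩ (shift P g)^[n + 1 + j] ⁻¹' cylinder P g η k) := by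
  obtain ⟨B, hB₁, hB₂⟩ := h.exists_bigImages hQ hm htr
  -- One connecting sequence is fixed per pair of letters. Only the finitely many pairs from `B` are
  -- used, so the masses of the connecting words have a positive minimum and their lengths a
  -- maximum.
  choose θ l hθ hl using exists_sequence_through (P := P) (g := g) htr
  obtain ⟨ω₀⟩ : Nonempty (ShiftSpace P g) := by
    by_contra hne
    rw [not_nonempty_iff] at hne
    have : m Set.univ = 0 := by rw [Set.univ_eq_empty_iff.2 hne, measure_empty]
    simp at this
  have hBne : (B ×ˢ B).Nonempty := by
    obtain ⟨b, hb, -⟩ := hB₁ (ω₀.1 0)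
    exact ⟨(b, b), by simp [hb]⟩
  obtain ⟨p, -, hp⟩ := Finset.exists_min_image (B ×ˢ B)
    (fun p => m.real (cylinder P g (θ p.1 p.2) (l p.1 p.2 + 1))) hBne
  set c₀ := m.real (cylinder P g (θ p.1 p.2) (l p.1 p.2 + 1)) with hc₀
  have hc₀pos : 0 < c₀ := h.pos _ _ (by omega)
  -- Two concatenations, each costing a factor `Q`; the gap is the number l + 1 of letters of the
  -- connecting word.
  refine ⟨(B ×ˢ B).sup fun p => l p.1 p.2 + 1, c₀ / Q ^ 2, by positivity, fun ω η n k hk => ?_⟩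
  obtain ⟨b, hb, hωb⟩ := hB₁ (ω.1 n)
  obtain ⟨a, ha, haη⟩ := hB₂ (η.1 0)
  have ht₁ : Transition P g ((θ b a).1 (l b a)) (η.1 0) := by rwa [hl]
  set ζ := concat (θ b a) η (l b a) ht₁ with hζ
  have ht₂ : Transition P g (ω.1 n) (ζ.1 0) := by
    rw [hζ, concat_apply_lt ht₁ (by omega), hθ]
    exact hωb
  have hmem : (b, a) ∈ B ×ˢ B := Finset.mem_product.2 ⟨hb, ha⟩
  refine ⟨l b a + 1, Finset.le_sup (f := fun p : A × A => l p.1 p.2 + 1) hmem, ?_⟩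
  set ξ := concat ω ζ n ht₂ with hξ
  have h₁ := h.le_concat hk ht₁
  have h₂ := h.le_concat (ω := ω) (η := ζ) (n := n) (k := l b a + 1 + k) (by omega) ht₂
  have h₃ := hp _ hmem
  have hsub : cylinder P g ξ (n + 1 + (l b a + 1 + k)) ⊆
      cylinder P g ω (n + 1) ∩ (shift P g)^[n + 1 + (l b a + 1)] ⁻¹' cylinder P g η k := by
    intro x hx
    refine ⟨fun j hj => ?_, fun j hj => ?_⟩
    · rw [hx j (by omega), hξ, concat_apply_lt ht₂ hj]
    · rw [iterate_shift_apply, hx _ (by omega),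
        show j + (n + 1 + (l b a + 1)) = j + (l b a + 1) + (n + 1) by ring, hξ,
        concat_apply_add ht₂, hζ, concat_apply_add ht₁]
  refine le_trans ?_ (measureReal_mono hsub)
  have hω := h.pos ω (n + 1) (by omega)
  have hη := h.pos η k hk
  rw [div_mul_eq_mul_div, div_mul_eq_mul_div, div_le_iff₀ (by positivity)]
  calc c₀ * m.real (cylinder P g ω (n + 1)) * m.real (cylinder P g η k)
      = m.real (cylinder P g ω (n + 1)) * (c₀ * m.real (cylinder P g η k)) := by ring
    _ ≤ m.real (cylinder P g ω (n + 1)) *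
          (Q * m.real (cylinder P g ζ (l b a + 1 + k))) := by
        exact mul_le_mul_of_nonneg_left ((mul_le_mul_of_nonneg_right h₃ hη.le).trans h₁) hω.le
    _ = Q * (m.real (cylinder P g ω (n + 1)) * m.real (cylinder P g ζ (l b a + 1 + k))) := by
        ring
    _ ≤ Q * (Q * m.real (cylinder P g ξ (n + 1 + (l b a + 1 + k)))) := by gcongr
    _ = _ := by ring

/-- The gap `j` depends on the pair of cylinders, so for unions of cylinders all gaps up to `L` are
summed. The extension is again made in `V` first and then in `U`. -/
theorem measure_mul_le_sum_of_joining {L : ℕ} {c : ℝ} (hc : 0 < c)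
    (hj : ∀ (ω η : ShiftSpace P g) (n k : ℕ), 1 ≤ k →
      ∃ j ≤ L, c * m.real (cylinder P g ω (n + 1)) * m.real (cylinder P g η k) ≤
        m.real (cylinder P g ω (n + 1) ∩ (shift P g)^[n + 1 + j] ⁻¹' cylinder P g η k))
    {n k : ℕ} (hk : 1 ≤ k) {U V : Set (ShiftSpace P g)} (hU : IsSaturated (n + 1) U)
    (hV : IsSaturated k V) :
    ENNReal.ofReal c * m U * m V ≤
      ∑ j ∈ Finset.range (L + 1), m (U ∩ (shift P g)^[n + 1 + j] ⁻¹' V) := by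
  have hs : ∀ j {V : Set (ShiftSpace P g)}, MeasurableSet V →
      MeasurableSet ((shift P g)^[j] ⁻¹' V) := fun j V hV => measurable_iterate_shift j hV
  have hcyl : ∀ ω η : ShiftSpace P g,
      ENNReal.ofReal c * m (cylinder P g ω (n + 1)) * m (cylinder P g η k) ≤
        ∑ j ∈ Finset.range (L + 1),
          m (cylinder P g ω (n + 1) ∩ (shift P g)^[n + 1 + j] ⁻¹' cylinder P g η k) := by
    intro ω η
    obtain ⟨j, hjL, hj⟩ := hj ω η n k hk
    refine le_trans ?_ (Finset.single_le_sum (fun _ _ => zero_le)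
      (Finset.mem_range.2 (Nat.lt_succ_of_le hjL)))
    rw [← ofReal_measureReal (μ := m) (s := cylinder P g ω (n + 1)),
      ← ofReal_measureReal (μ := m) (s := cylinder P g η k), ← ENNReal.ofReal_mul hc.le,
      ← ENNReal.ofReal_mul (by positivity), ← ofReal_measureReal]
    exact ENNReal.ofReal_le_ofReal hj
  have h₁ : ∀ ω : ShiftSpace P g, ENNReal.ofReal c * m (cylinder P g ω (n + 1)) * m V ≤
      ∑ j ∈ Finset.range (L + 1),
        m (cylinder P g ω (n + 1) ∩ (shift P g)^[n + 1 + j] ⁻¹' V) := by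
    intro ω
    have key : ∀ V, MeasurableSet V →
        (∑ j ∈ Finset.range (L + 1),
          (m.restrict (cylinder P g ω (n + 1))).map ((shift P g)^[n + 1 + j])) V =
        ∑ j ∈ Finset.range (L + 1),
          m (cylinder P g ω (n + 1) ∩ (shift P g)^[n + 1 + j] ⁻¹' V) := by
      intro V hV
      rw [Measure.finsetSum_apply]
      refine Finset.sum_congr rfl fun j _ => ?_
      rw [Measure.map_apply (measurable_iterate_shift _) hV, Measure.restrict_apply (hs _ hV),
        Set.inter_comm]
    have := measure_le_of_forall_cylinder
      (ρ₁ := (ENNReal.ofReal c * m (cylinder P g ω (n + 1))) • m)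
      (ρ₂ := ∑ j ∈ Finset.range (L + 1),
        (m.restrict (cylinder P g ω (n + 1))).map ((shift P g)^[n + 1 + j])) (n := k)
      (fun η => by
        rw [key _ (measurableSet_cylinder _ _)]
        exact hcyl ω η) hV
    rwa [key _ hV.measurableSet] at this
  have key : ∀ U, MeasurableSet U →
      (∑ j ∈ Finset.range (L + 1), m.restrict ((shift P g)^[n + 1 + j] ⁻¹' V)) U =
        ∑ j ∈ Finset.range (L + 1), m (U ∩ (shift P g)^[n + 1 + j] ⁻¹' V) := by
    intro U hU
    rw [Measure.finsetSum_apply]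
    exact Finset.sum_congr rfl fun j _ => Measure.restrict_apply hU
  have h₂ := measure_le_of_forall_cylinder (ρ₁ := (ENNReal.ofReal c * m V) • m)
    (ρ₂ := ∑ j ∈ Finset.range (L + 1), m.restrict ((shift P g)^[n + 1 + j] ⁻¹' V)) (n := n + 1)
    (fun ω => by
      rw [key _ (measurableSet_cylinder _ _)]
      refine le_trans (le_of_eq ?_) (h₁ ω)
      rw [Measure.smul_apply, smul_eq_mul]
      ring) hU
  rw [key _ hU.measurableSet] at h₂
  refine le_trans (le_of_eq ?_) h₂
  rw [Measure.smul_apply, smul_eq_mul]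
  ring

/-- The probability of avoiding a union `V` of `q`-cylinders decays exponentially in the number of
blocks of length `q + L`. -/
theorem IsQuasiBernoulli.exists_avoid_le (h : IsQuasiBernoulli m Q) (hQ : 0 < Q)
    (hm : MeasurePreserving (shift P g) m m)
    (htr : ∀ a b, Relation.TransGen (Transition P g) a b) :
    ∃ (L : ℕ) (c : ℝ), 0 < c ∧ ∀ (q : ℕ) (V : Set (ShiftSpace P g)), 1 ≤ q → IsSaturated q V →
      ∀ k : ℕ, m.real {ω | ∀ j, j + q ≤ 1 + k * (q + L) → (shift P g)^[j] ω ∉ V} ≤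
        Real.exp (-(c * m.real V * k)) := by
  obtain ⟨L, c, hc, hj⟩ := h.exists_joining hQ hm htr
  refine ⟨L, c / (L + 1), by positivity, fun q V hq hV k => ?_⟩
  set N : ℕ → ℕ := fun k => k * (q + L) with hN
  -- The constraint keeps all tested windows inside the first N k + 1 letters, which makes `U k`
  -- saturated at that length. The extra 1 matches the cylinders of length n + 1 in the joining
  -- estimate.
  set U : ℕ → Set (ShiftSpace P g) :=
    fun k => {ω | ∀ j, j + q ≤ 1 + k * (q + L) → (shift P g)^[j] ω ∉ V} with hU
  have hsat : ∀ k, IsSaturated (N k + 1) (U k) := by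
    intro k ω hω η hη j hjk hmem
    refine hω j hjk (hV _ hmem fun i hi => ?_)
    rw [iterate_shift_apply, iterate_shift_apply]
    exact (hη (i + j) (by simp only [hN]; omega)).symm
  have hstep : ∀ k, m.real (U (k + 1)) ≤ m.real (U k) * (1 - c / (L + 1) * m.real V) := by
    intro k
    set W : ℕ → Set (ShiftSpace P g) := fun j => (shift P g)^[N k + 1 + j] ⁻¹' V with hW
    -- A visit to `V` at time N k + 1 + j with j ≤ L has its window inside the next block, so such
    -- points are lost from `U k` to `U (k + 1)`. Averaging over the L + 1 gaps shows that a
    -- fraction at least c m(V)/(L + 1) is lost.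
    have hdis : ∀ j ∈ Finset.range (L + 1), m.real (U k ∩ W j) ≤ m.real (U k) - m.real (U (k + 1)) := by
      intro j hjL
      have hlt := Finset.mem_range.1 hjL
      have hsub : U k ∩ W j ⊆ U k \ U (k + 1) := by
        rintro ω ⟨h₁, h₂⟩
        refine ⟨h₁, fun h₃ => h₃ (N k + 1 + j) ?_ h₂⟩
        simp only [hN, Nat.succ_mul, add_mul]
        omega
      have hmono : U (k + 1) ⊆ U k := by
        intro ω hω j hjk
        refine hω j (hjk.trans ?_)
        gcongr
        omega
      rw [← measureReal_sdiff hmono (hsat (k + 1)).measurableSet]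
      exact measureReal_mono hsub
    have hsum := measure_mul_le_sum_of_joining hc hj hq (hsat k) hV
    have hsum' : c * m.real (U k) * m.real V ≤
        ∑ j ∈ Finset.range (L + 1), m.real (U k ∩ W j) := by
      have := ENNReal.toReal_mono (by
        exact (ENNReal.sum_ne_top.2 fun _ _ => measure_ne_top _ _)) hsum
      rwa [ENNReal.toReal_sum (fun _ _ => measure_ne_top _ _), ENNReal.toReal_mul,
        ENNReal.toReal_mul, ENNReal.toReal_ofReal hc.le] at this
    have h₁ := hsum'.trans (Finset.sum_le_card_nsmul _ _ _ hdis)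
    rw [Finset.card_range, nsmul_eq_mul] at h₁
    push_cast at h₁
    have hL : (0 : ℝ) < L + 1 := by positivity
    have h₂ : c / (L + 1) * m.real V * m.real (U k) ≤ m.real (U k) - m.real (U (k + 1)) := by
      rw [div_mul_eq_mul_div, div_mul_eq_mul_div, div_le_iff₀ hL]
      linarith
    linarith
  have hexp : ∀ k : ℕ, m.real (U k) ≤ Real.exp (-(c / (L + 1) * m.real V * k)) := by
    intro k
    induction k with
    | zero => simp
    | succ k ih =>
      calc m.real (U (k + 1)) ≤ m.real (U k) * (1 - c / (L + 1) * m.real V) := hstep k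
        _ ≤ m.real (U k) * Real.exp (-(c / (L + 1) * m.real V)) := by
          gcongr
          linarith [Real.add_one_le_exp (-(c / (L + 1) * m.real V))]
        _ ≤ Real.exp (-(c / (L + 1) * m.real V * k)) * Real.exp (-(c / (L + 1) * m.real V)) := by
          gcongr
        _ = _ := by
          rw [← Real.exp_add]
          push_cast
          ring_nf
  exact hexp k

end Mixing

/-! ### Gibbs–Markov maps: contraction along itineraries, invariance, full support -/

section GibbsMarkov

/-- Mean value theorem: the open segment between two points of an interval lies in its interior,
where the derivative is controlled. -/
theorem IsExpandingMarkov.exists_expanding {A : Type*} {P : A → Set ℝ} {g : ℝ → ℝ}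
    (h : IsExpandingMarkov P g) :
    ∃ γ : ℝ, 1 < γ ∧ ∀ a, ∀ x ∈ P a, ∀ y ∈ P a, γ * |x - y| ≤ |g x - g y| := by
  obtain ⟨γ, hγ, hd⟩ := h.expanding
  refine ⟨γ, hγ, fun a => ?_⟩
  have key : ∀ x ∈ P a, ∀ y ∈ P a, x < y → γ * |x - y| ≤ |g x - g y| := by
    intro x hx y hy hxy
    have hIcc : Set.Icc x y ⊆ P a := (h.ordConnected a).out hx hy
    have hIoo : Set.Ioo x y ⊆ interior (P a) :=
      interior_maximal (Set.Ioo_subset_Icc_self.trans hIcc) isOpen_Ioo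
    obtain ⟨c, hc, hcd⟩ := exists_deriv_eq_slope g hxy ((h.continuousOn a).mono hIcc)
      fun z hz => (hd a z (hIoo hz)).1.differentiableWithinAt
    have h₁ := (hd a c (hIoo hc)).2
    rw [hcd, abs_div, le_div_iff₀ (abs_pos.2 (sub_pos.2 hxy).ne')] at h₁
    rwa [abs_sub_comm x y, abs_sub_comm (g x)]
  intro x hx y hy
  rcases lt_trichotomy x y with hxy | rfl | hxy
  · exact key x hx y hy hxy
  · simp
  · rw [abs_sub_comm x y, abs_sub_comm (g x)]
    exact key y hy x hx hxy

variable {Y : Type*} [MetricSpace Y] [MeasurableSpace Y] {F : Y → Y} {μ : Measure Y}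
  {A : Type*} [MeasurableSpace A] {P : A → Set ℝ} {g : ℝ → ℝ} {ι : Y → ℝ}

namespace IsGibbsMarkov

theorem coord_mem (H : IsGibbsMarkov F μ P g ι) (y : Y) : ∃ a, ι y ∈ P a := by
  have h : ι y ∈ repeller P g := H.range_eq ▸ Set.mem_range_self y
  simpa using h 0

theorem abs_coord_sub_le (H : IsGibbsMarkov F μ P g ι) (y z : Y) : |ι y - ι z| ≤ 1 := by
  obtain ⟨a, ha⟩ := H.coord_mem y
  obtain ⟨b, hb⟩ := H.coord_mem z
  have h₁ := H.expandingMarkov.subset_unit a ha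
  have h₂ := H.expandingMarkov.subset_unit b hb
  rw [abs_le]
  constructor <;> linarith [h₁.1, h₁.2, h₂.1, h₂.2]

/-- Two points with the same itinerary up to time `n` are exponentially close. -/
theorem exists_contraction (H : IsGibbsMarkov F μ P g ι) :
    ∃ L γ : ℝ, 0 < L ∧ 1 < γ ∧ ∀ (w : ℕ → A) (n : ℕ) (y z : Y),
      (∀ k < n, ι (F^[k] y) ∈ P (w k)) → (∀ k < n, ι (F^[k] z) ∈ P (w k)) →
      dist y z ≤ L / γ ^ n := by
  obtain ⟨γ, hγ, hexp⟩ := H.expandingMarkov.exists_expanding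
  obtain ⟨L, -, hL⟩ := H.biLipschitz
  -- The Lipschitz constant may vanish; adding 1 makes it positive. Coordinate distances grow by γ
  -- at each common letter and never exceed 1.
  refine ⟨L + 1, γ, by positivity, hγ, fun w n y z hy hz => ?_⟩
  have hγ0 : 0 < γ := one_pos.trans hγ
  have h₁ : ∀ k ≤ n, γ ^ k * |ι y - ι z| ≤ |ι (F^[k] y) - ι (F^[k] z)| := by
    intro k hk
    induction k with
    | zero => simp
    | succ k ih =>
      calc γ ^ (k + 1) * |ι y - ι z| = γ * (γ ^ k * |ι y - ι z|) := by ring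
        _ ≤ γ * |ι (F^[k] y) - ι (F^[k] z)| := by gcongr; exact ih (by omega)
        _ ≤ |g (ι (F^[k] y)) - g (ι (F^[k] z))| :=
          hexp (w k) _ (hy k (by omega)) _ (hz k (by omega))
        _ = _ := by
          rw [Function.iterate_succ_apply', Function.iterate_succ_apply', H.conj, H.conj]
  have h₂ := (h₁ n le_rfl).trans (H.abs_coord_sub_le _ _)
  have h₃ : dist y z ≤ L * |ι y - ι z| := by
    have := hL.le_mul_dist y z
    rwa [Real.dist_eq] at this
  rw [le_div_iff₀ (by positivity)]
  calc dist y z * γ ^ n ≤ (L * |ι y - ι z|) * γ ^ n := by gcongr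
    _ = L * (γ ^ n * |ι y - ι z|) := by ring
    _ ≤ L * 1 := by gcongr
    _ ≤ L + 1 := by linarith

/-- Every point of the repeller has an admissible itinerary. -/
theorem exists_itinerary (H : IsGibbsMarkov F μ P g ι) (y : Y) :
    ∃ ω : ShiftSpace P g, ∀ k, ι (F^[k] y) ∈ P (ω.1 k) := by
  have hstep : ∀ (k : ℕ) (a : {a // ι (F^[k] y) ∈ P a}),
      ∃ b : {b // ι (F^[k + 1] y) ∈ P b}, Transition P g a b := by
    rintro k ⟨a, ha⟩
    -- The next letter is taken from the elements that make up the image: an arbitrary interval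
    -- containing the next iterate might meet the image only at an endpoint.
    obtain ⟨S, hS⟩ := H.expandingMarkov.markov a
    have hmem : ι (F^[k + 1] y) ∈ g '' P a ∩ ⋃ b, P b := by
      refine ⟨⟨_, ha, ?_⟩, Set.mem_iUnion.2 (H.coord_mem _)⟩
      rw [Function.iterate_succ_apply', H.conj]
    rw [hS] at hmem
    obtain ⟨b, hb, hyb⟩ := Set.mem_iUnion₂.1 hmem
    refine ⟨⟨b, hyb⟩, fun x hx => ?_⟩
    have : x ∈ g '' P a ∩ ⋃ b, P b := hS ▸ Set.mem_iUnion₂.2 ⟨b, hb, hx⟩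
    exact this.1
  choose s hs using hstep
  obtain ⟨a, ha⟩ := H.coord_mem y
  set w : ∀ k, {a // ι (F^[k] y) ∈ P a} := fun k => Nat.rec ⟨a, ha⟩ s k with hw
  exact ⟨⟨fun k => (w k).1, fun k => hs k (w k)⟩, fun k => (w k).2⟩

theorem continuous_coord (H : IsGibbsMarkov F μ P g ι) : Continuous ι :=
  let ⟨_, hL, _⟩ := H.biLipschitz
  hL.continuous

theorem isEmbedding_coord (H : IsGibbsMarkov F μ P g ι) : IsEmbedding ι := by
  obtain ⟨L, hL, hL'⟩ := H.biLipschitz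
  exact (hL'.isUniformEmbedding hL.uniformContinuous).isEmbedding

theorem secondCountable (H : IsGibbsMarkov F μ P g ι) : SecondCountableTopology Y :=
  H.isEmbedding_coord.isInducing.secondCountableTopology

/-- In the coordinate the map is continuous on each of countably many intervals, and the coordinate
is an embedding. -/
theorem measurable_map [BorelSpace Y] [Countable A] (H : IsGibbsMarkov F μ P g ι) :
    Measurable F := by
  have hιF : Measurable (fun y => ι (F y)) := by
    refine measurable_of_isOpen fun U hU => ?_
    have hpre : (fun y => ι (F y)) ⁻¹' U = ⋃ a, ι ⁻¹' (P a ∩ g ⁻¹' U) := by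
      ext y
      obtain ⟨a, ha⟩ := H.coord_mem y
      simp only [Set.mem_preimage, Set.mem_iUnion, Set.mem_inter_iff, H.conj]
      exact ⟨fun h => ⟨a, ha, h⟩, fun ⟨_, _, h⟩ => h⟩
    rw [hpre]
    refine MeasurableSet.iUnion fun a => H.continuous_coord.measurable ?_
    obtain ⟨V, hV, hVU⟩ := (continuousOn_iff'.1 (H.expandingMarkov.continuousOn a)) U hU
    rw [Set.inter_comm, hVU]
    exact hV.measurableSet.inter (H.expandingMarkov.ordConnected a).measurableSet
  refine measurable_of_isOpen fun U hU => ?_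
  obtain ⟨V, hV, rfl⟩ := H.isEmbedding_coord.isInducing.isOpen_iff.1 hU
  exact hιF hV.measurableSet

variable [BorelSpace Y] [Countable A] [DiscreteMeasurableSpace A]

omit [DiscreteMeasurableSpace A] in
-- The points F(π ω) and π(σ ω) share an infinite itinerary for almost every ω, hence coincide by
-- contraction. So the coding transports the invariance of the shift.
theorem measurePreserving (H : IsGibbsMarkov F μ P g ι) : MeasurePreserving F μ μ := by
  obtain ⟨m, hm, hσ, ⟨π, hπ, hcode⟩, -⟩ := H.gibbs
  obtain ⟨L, γ, hL, hγ, hcon⟩ := H.exists_contraction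
  have hconj : F ∘ π =ᵐ[m] π ∘ shift P g := by
    filter_upwards [hcode, hσ.quasiMeasurePreserving.ae hcode] with ω h₁ h₂
    have hd : ∀ n : ℕ, dist (F (π ω)) (π (shift P g ω)) ≤ L / γ ^ n := fun n =>
      hcon (fun k => ω.1 (k + 1)) n _ _
        (fun k _ => by rw [← Function.iterate_succ_apply]; exact h₁ (k + 1)) fun k _ => h₂ k
    have hlim : Tendsto (fun n : ℕ => L / γ ^ n) atTop (𝓝 0) :=
      tendsto_const_nhds.div_atTop (tendsto_pow_atTop_atTop_of_one_lt hγ)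
    exact dist_le_zero.1 (ge_of_tendsto' hlim hd)
  refine ⟨H.measurable_map, ?_⟩
  conv_lhs => rw [← hπ.map_eq]
  rw [Measure.map_map H.measurable_map hπ.measurable, Measure.map_congr hconj,
    ← Measure.map_map hπ.measurable hσ.measurable, hσ.map_eq, hπ.map_eq]

omit [Countable A] [DiscreteMeasurableSpace A] in
-- A long cylinder along an itinerary of `y` has positive mass and almost all of it projects into
-- the ball.
theorem measure_ball_pos (H : IsGibbsMarkov F μ P g ι) (y : Y) {r : ℝ} (hr : 0 < r) :
    0 < μ (Metric.ball y r) := by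
  obtain ⟨m, hm, hσ, ⟨π, hπ, hcode⟩, φ, -, hφ⟩ := H.gibbs
  obtain ⟨Q, hQ, hqb⟩ := hφ.exists_isQuasiBernoulli
  obtain ⟨L, γ, hL, hγ, hcon⟩ := H.exists_contraction
  obtain ⟨ω, hω⟩ := H.exists_itinerary y
  have hlim : Tendsto (fun n : ℕ => L / γ ^ n) atTop (𝓝 0) :=
    tendsto_const_nhds.div_atTop (tendsto_pow_atTop_atTop_of_one_lt hγ)
  obtain ⟨n, hn, hn1⟩ := ((hlim.eventually (gt_mem_nhds hr)).and (eventually_ge_atTop 1)).exists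
  have hpos := hqb.pos ω n hn1
  rw [measureReal_def, ENNReal.toReal_pos_iff] at hpos
  rw [← hπ.measure_preimage Metric.isOpen_ball.measurableSet.nullMeasurableSet]
  refine hpos.1.trans_le (measure_mono_ae ?_)
  filter_upwards [hcode] with η hη hmem
  refine lt_of_le_of_lt (hcon ω.1 n _ _ (fun k hk => ?_) fun k _ => hω k) hn
  have : η.1 k = ω.1 k := hmem k hk
  rw [← this]
  exact hη k

omit [Countable A] [DiscreteMeasurableSpace A] in
theorem support_eq_univ (H : IsGibbsMarkov F μ P g ι) : μ.support = Set.univ := by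
  refine Set.eq_univ_of_forall fun y => ?_
  rw [Metric.nhds_basis_ball.mem_measureSupport]
  exact fun r hr => H.measure_ball_pos y hr

/-- The probability that an orbit avoids a ball of radius `2ρ` for `k` blocks of length `q + L`
decays exponentially in `k`, provided that itineraries of length `q` determine points up to `ρ`. -/
theorem exists_avoid_ball_le (H : IsGibbsMarkov F μ P g ι) :
    ∃ (N₀ : ℕ) (c D γ : ℝ), 0 < c ∧ 0 < D ∧ 1 < γ ∧ ∀ (q : ℕ) (ρ : ℝ) (z : Y), 1 ≤ q →
      D / γ ^ q < ρ → ∀ k : ℕ,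
        μ.real {y | ∀ j < 2 + k * (q + N₀), 2 * ρ ≤ dist (F^[j] y) z} ≤
          Real.exp (-(c * μ.real (Metric.ball z ρ) * k)) := by
  have hFm := H.measurable_map
  obtain ⟨m, hm, hσ, ⟨π, hπ, hcode⟩, φ, -, hφ⟩ := H.gibbs
  obtain ⟨Q, hQ, hqb⟩ := hφ.exists_isQuasiBernoulli
  obtain ⟨D, γ, hD, hγ, hcon⟩ := H.exists_contraction
  obtain ⟨N₀, c, hc, havoid⟩ := hqb.exists_avoid_le hQ hσ H.transitive
  refine ⟨N₀, c, D, γ, hc, hD, hγ, fun q ρ z hq hρ k => ?_⟩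
  -- The saturation of the preimage of the ball: cylinders containing a correctly coded sequence
  -- that projects into it. Its mass is at least that of the ball, and an orbit entering it is
  -- within D/γ^q + ρ < 2ρ of `z`.
  set V : Set (ShiftSpace P g) := {ω | ∃ η : ShiftSpace P g, (∀ k, ι (F^[k] (π η)) ∈ P (η.1 k)) ∧
    η ∈ cylinder P g ω q ∧ dist (π η) z < ρ} with hVdef
  have hV : IsSaturated q V := by
    rintro ω ⟨η, h₁, h₂, h₃⟩ ω' hω'
    refine ⟨η, h₁, ?_, h₃⟩
    rwa [cylinder_eq_of_mem hω']
  have hball : μ.real (Metric.ball z ρ) ≤ m.real V := by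
    rw [measureReal_def, measureReal_def,
      ← hπ.measure_preimage Metric.isOpen_ball.measurableSet.nullMeasurableSet]
    refine ENNReal.toReal_mono (measure_ne_top _ _) (measure_mono_ae ?_)
    filter_upwards [hcode] with η hη hmem
    exact ⟨η, hη, mem_cylinder_self _ _, hmem⟩
  have hmeas : MeasurableSet {y | ∀ j < 2 + k * (q + N₀), 2 * ρ ≤ dist (F^[j] y) z} := by
    have : {y | ∀ j < 2 + k * (q + N₀), 2 * ρ ≤ dist (F^[j] y) z} =
        ⋂ j, ⋂ (_ : j < 2 + k * (q + N₀)), F^[j] ⁻¹' (Metric.ball z (2 * ρ))ᶜ := by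
      ext y
      simp [Metric.mem_ball]
    rw [this]
    exact MeasurableSet.iInter fun j => MeasurableSet.iInter fun _ =>
      (hFm.iterate j) Metric.isOpen_ball.measurableSet.compl
  calc μ.real {y | ∀ j < 2 + k * (q + N₀), 2 * ρ ≤ dist (F^[j] y) z}
      ≤ m.real {ω | ∀ j, j + q ≤ 1 + k * (q + N₀) → (shift P g)^[j] ω ∉ V} := by
        rw [measureReal_def, measureReal_def, ← hπ.measure_preimage hmeas.nullMeasurableSet]
        refine ENNReal.toReal_mono (measure_ne_top _ _) (measure_mono_ae ?_)
        filter_upwards [hcode] with ω hω hmem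
        rintro j hj ⟨η, h₁, h₂, h₃⟩
        refine absurd (hmem j (by omega)) (not_le.2 ?_)
        have hdist : dist (F^[j] (π ω)) (π η) ≤ D / γ ^ q := by
          refine hcon η.1 q _ _ (fun i hi => ?_) fun i _ => h₁ i
          have h₄ : η.1 i = ω.1 (i + j) := by
            have := h₂ i hi
            rwa [iterate_shift_apply] at this
          rw [h₄, ← Function.iterate_add_apply]
          exact hω (i + j)
        calc dist (F^[j] (π ω)) z ≤ dist (F^[j] (π ω)) (π η) + dist (π η) z := dist_triangle _ _ _
          _ < 2 * ρ := by linarith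
    _ ≤ Real.exp (-(c * m.real V * k)) := havoid q V hq hV k
    _ ≤ _ := by
        refine Real.exp_le_exp.2 (neg_le_neg ?_)
        gcongr

end IsGibbsMarkov

end GibbsMarkov

/-! ### Logarithmic quotients in the extended reals -/

section LogQuotients

/-- Dividing by log r < 0 reverses the order. The masses 0 and ∞ give the quotients ⊤ and ⊥, for
which both sides are false and true respectively. -/
theorem log_div_lt_iff_of_neg {M : ℝ≥0∞} {r β : ℝ} (hr : 0 < r) (hr1 : r < 1) :
    ENNReal.log M / ((Real.log r : ℝ) : EReal) < β ↔ ENNReal.ofReal (r ^ β) < M := by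
  have hlog : Real.log r < 0 := Real.log_neg hr hr1
  have hpos : 0 < r ^ β := Real.rpow_pos_of_pos hr β
  induction M using ENNReal.recTopCoe with
  | top =>
    simp [EReal.top_div_of_neg_ne_bot (EReal.coe_neg'.2 hlog) (EReal.coe_ne_bot _)]
  | coe x =>
    rcases eq_or_ne x 0 with rfl | hx
    · simp [EReal.bot_div_of_neg_ne_bot (EReal.coe_neg'.2 hlog) (EReal.coe_ne_bot _)]
    · have hx0 : 0 < (x : ℝ) := NNReal.coe_pos.2 (pos_iff_ne_zero.2 hx)
      rw [ENNReal.log_pos_real (by simpa using hx) ENNReal.coe_ne_top, ← EReal.coe_div,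
        EReal.coe_lt_coe_iff, div_lt_iff_of_neg hlog, ENNReal.coe_toReal,
        ← Real.log_rpow hr, Real.log_lt_log_iff hpos hx0, ← ENNReal.ofReal_coe_nnreal,
        ENNReal.ofReal_lt_ofReal_iff hx0]

theorem lt_log_div_iff_of_neg {M : ℝ≥0∞} {r β : ℝ} (hr : 0 < r) (hr1 : r < 1) :
    (β : EReal) < ENNReal.log M / ((Real.log r : ℝ) : EReal) ↔ M < ENNReal.ofReal (r ^ β) := by
  have hlog : Real.log r < 0 := Real.log_neg hr hr1
  have hpos : 0 < r ^ β := Real.rpow_pos_of_pos hr β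
  induction M using ENNReal.recTopCoe with
  | top =>
    simp [EReal.top_div_of_neg_ne_bot (EReal.coe_neg'.2 hlog) (EReal.coe_ne_bot _)]
  | coe x =>
    rcases eq_or_ne x 0 with rfl | hx
    · simp [EReal.bot_div_of_neg_ne_bot (EReal.coe_neg'.2 hlog) (EReal.coe_ne_bot _), hpos]
    · have hx0 : 0 < (x : ℝ) := NNReal.coe_pos.2 (pos_iff_ne_zero.2 hx)
      rw [ENNReal.log_pos_real (by simpa using hx) ENNReal.coe_ne_top, ← EReal.coe_div,
        EReal.coe_lt_coe_iff, lt_div_iff_of_neg hlog, ENNReal.coe_toReal,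
        ← Real.log_rpow hr, Real.log_lt_log_iff hx0 hpos, ← ENNReal.ofReal_coe_nnreal,
        ENNReal.ofReal_lt_ofReal_iff hpos]

theorem log_div_neg_log_le_iff {τ : ℝ≥0∞} {r β : ℝ} (hr : 0 < r) (hr1 : r < 1) :
    ENNReal.log τ / ((-Real.log r : ℝ) : EReal) ≤ β ↔ τ ≤ ENNReal.ofReal (r ^ (-β)) := by
  have h : ENNReal.log τ / ((-Real.log r : ℝ) : EReal) =
      -(ENNReal.log τ / ((Real.log r : ℝ) : EReal)) := by
    rw [EReal.div_eq_inv_mul, EReal.div_eq_inv_mul, ← EReal.coe_inv, ← EReal.coe_inv, inv_neg,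
      EReal.coe_neg, EReal.neg_mul]
  rw [h, EReal.neg_le, ← EReal.coe_neg, ← not_lt, log_div_lt_iff_of_neg hr hr1, not_lt]

theorem le_log_div_neg_log_iff {τ : ℝ≥0∞} {r β : ℝ} (hr : 0 < r) (hr1 : r < 1) :
    (β : EReal) ≤ ENNReal.log τ / ((-Real.log r : ℝ) : EReal) ↔
      ENNReal.ofReal (r ^ (-β)) ≤ τ := by
  have h : ENNReal.log τ / ((-Real.log r : ℝ) : EReal) =
      -(ENNReal.log τ / ((Real.log r : ℝ) : EReal)) := by
    rw [EReal.div_eq_inv_mul, EReal.div_eq_inv_mul, ← EReal.coe_inv, ← EReal.coe_inv, inv_neg,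
      EReal.coe_neg, EReal.neg_mul]
  rw [h, EReal.le_neg, ← EReal.coe_neg, ← not_lt, lt_log_div_iff_of_neg hr hr1, not_lt]

theorem eventually_mem_Ioo_zero_one : ∀ᶠ r : ℝ in 𝓝[>] 0, 0 < r ∧ r < 1 :=
  Ioo_mem_nhdsGT one_pos

theorem eventually_lt_minBall {X : Type*} [PseudoMetricSpace X] [MeasurableSpace X]
    {μ : Measure X} {β : ℝ} (h : upperMinkowskiDim μ < β) :
    ∀ᶠ r : ℝ in 𝓝[>] 0, ENNReal.ofReal (r ^ β) < minBall μ r := by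
  filter_upwards [eventually_lt_of_limsup_lt h, eventually_mem_Ioo_zero_one] with r hr hr01
  exact (log_div_lt_iff_of_neg hr01.1 hr01.2).1 hr

theorem eventually_minBall_lt {X : Type*} [PseudoMetricSpace X] [MeasurableSpace X]
    {μ : Measure X} {α : ℝ} (h : α < lowerMinkowskiDim μ) :
    ∀ᶠ r : ℝ in 𝓝[>] 0, minBall μ r < ENNReal.ofReal (r ^ α) := by
  filter_upwards [eventually_lt_of_lt_liminf h, eventually_mem_Ioo_zero_one] with r hr hr01
  exact (lt_log_div_iff_of_neg hr01.1 hr01.2).1 hr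

end LogQuotients

/-! ### Covering the section by orbits of the Poincaré map -/

section SectionCover

/-- A measure whose balls of radius `ρ` have mass at least `M` admits a `2ρ`-net with at most
`1 / M` points. -/
theorem exists_net {Y : Type*} [MetricSpace Y] [MeasurableSpace Y] [BorelSpace Y]
    {μ : Measure Y} [IsProbabilityMeasure μ] {ρ M : ℝ} (hM : 0 < M)
    (h : ∀ y, M ≤ μ.real (Metric.ball y ρ)) :
    ∃ Z : Finset Y, Z.card * M ≤ 1 ∧ ∀ y, ∃ z ∈ Z, dist y z < 2 * ρ := by
  have hcard : ∀ Z : Finset Y, (Z : Set Y).Pairwise (fun x y => 2 * ρ ≤ dist x y) →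
      Z.card * M ≤ 1 := by
    intro Z hZ
    have hdisj : (Z : Set Y).PairwiseDisjoint fun z => Metric.ball z ρ := fun x hx y hy hxy =>
      Metric.ball_disjoint_ball (by linarith [hZ hx hy hxy])
    calc (Z.card : ℝ) * M = ∑ _z ∈ Z, M := by simp
      _ ≤ ∑ z ∈ Z, μ.real (Metric.ball z ρ) := Finset.sum_le_sum fun z _ => h z
      _ = μ.real (⋃ z ∈ Z, Metric.ball z ρ) :=
        (measureReal_biUnion_finset hdisj fun _ _ => Metric.isOpen_ball.measurableSet).symm
      _ ≤ 1 := measureReal_le_one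
  by_contra! hcon
  -- Without a net, every separated set could be enlarged by one point, against the bound on its
  -- cardinality by disjoint balls.
  have hex : ∀ n : ℕ, ∃ Z : Finset Y, Z.card = n ∧
      (Z : Set Y).Pairwise (fun x y => 2 * ρ ≤ dist x y) := by
    classical
    intro n
    induction n with
    | zero => exact ⟨∅, by simp⟩
    | succ n ih =>
      obtain ⟨Z, hn, hZ⟩ := ih
      obtain ⟨y, hy⟩ := hcon Z (hcard Z hZ)
      have hyZ : y ∉ Z := by
        intro hmem
        have hpos : 0 < ρ := by
          by_contra hρ
          have := h y
          rw [Metric.ball_eq_empty.2 (not_lt.1 hρ), measureReal_empty] at this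
          exact absurd hM (not_lt.2 this)
        have := hy y hmem
        rw [dist_self] at this
        linarith
      refine ⟨insert y Z, by rw [Finset.card_insert_of_notMem hyZ, hn], ?_⟩
      rw [Finset.coe_insert]
      refine hZ.insert fun z hz _ => ⟨hy z hz, ?_⟩
      rw [dist_comm]
      exact hy z hz
  obtain ⟨n, hn⟩ := exists_nat_gt (1 / M)
  obtain ⟨Z, hZn, hZ⟩ := hex n
  have := hcard Z hZ
  rw [hZn] at this
  rw [div_lt_iff₀ hM] at hn
  linarith

/-- Since exp x ≥ x^p / p!, the terms are dominated by a geometric series of ratio v / u^p, which is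
below 1 for large `p`. -/
theorem summable_pow_mul_exp_neg_mul_pow {u v c : ℝ} (hu : 1 < u) (hv : 0 ≤ v) (hc : 0 < c) :
    Summable fun n : ℕ => v ^ n * Real.exp (-(c * u ^ n)) := by
  obtain ⟨p, hp⟩ := pow_unbounded_of_one_lt (2 * v) hu
  have hu0 : 0 < u := one_pos.trans hu
  have hup : 0 < u ^ p := by positivity
  have hlt : v / u ^ p < 1 := by
    rw [div_lt_one hup]
    linarith
  refine Summable.of_nonneg_of_le (fun n => by positivity) (fun n => ?_)
    ((summable_geometric_of_lt_one (by positivity) hlt).mul_left ((p.factorial : ℝ) / c ^ p))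
  have h₁ := Real.pow_div_factorial_le_exp (c * u ^ n) (by positivity) p
  have hfac : (0 : ℝ) < p.factorial := by positivity
  calc v ^ n * Real.exp (-(c * u ^ n)) = v ^ n / Real.exp (c * u ^ n) := by
        rw [Real.exp_neg, div_eq_mul_inv]
    _ ≤ v ^ n / ((c * u ^ n) ^ p / p.factorial) := by gcongr
    _ = (p.factorial : ℝ) / c ^ p * (v / u ^ p) ^ n := by
        rw [mul_pow, div_pow, ← pow_mul, ← pow_mul, mul_comm n p]
        field_simp

/-- Borel–Cantelli for sets that need not be measurable, as is the case for level sets of cover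
times. -/
theorem ae_eventually_notMem_of_summable {Ω : Type*} [MeasurableSpace Ω] {μ : Measure Ω}
    [IsFiniteMeasure μ] {s : ℕ → Set Ω} {b : ℕ → ℝ} (hb : Summable b)
    (h : ∀ᶠ n in atTop, μ.real (s n) ≤ b n) : ∀ᵐ x ∂μ, ∀ᶠ n in atTop, x ∉ s n := by
  have hs : Summable fun n => μ.real (s n) := by
    refine summable_of_isBigO_nat hb (Asymptotics.IsBigO.of_bound 1 ?_)
    filter_upwards [h] with n hn
    rw [one_mul, Real.norm_of_nonneg measureReal_nonneg]
    exact hn.trans (le_abs_self _)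
  refine ae_eventually_notMem ?_
  have := hs.tsum_ofReal_ne_top
  simpa only [ofReal_measureReal (measure_ne_top μ _)] using this

/-- Sums of `N n ≤ v ^ n` terms along an orbit are eventually at most `w ^ n`, for `w > v`. -/
theorem ae_eventually_sum_iterate_le {Ω : Type*} [MeasurableSpace Ω] {μ : Measure Ω}
    [IsProbabilityMeasure μ] {F : Ω → Ω} (hF : MeasurePreserving F μ μ) {R : Ω → ℝ}
    (hR : Integrable R μ) (hR0 : ∀ x, 0 ≤ R x) {N : ℕ → ℕ} {v w : ℝ} (hv : 0 < v) (hvw : v < w)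
    (hN : ∀ᶠ n in atTop, (N n : ℝ) ≤ v ^ n) :
    ∀ᵐ x ∂μ, ∀ᶠ n in atTop, ∑ j ∈ Finset.range (N n), R (F^[j] x) ≤ w ^ n := by
  have hw : 0 < w := hv.trans hvw
  have hint : ∀ j, Integrable (fun x => R (F^[j] x)) μ := fun j =>
    (hF.iterate j).integrable_comp_of_integrable hR
  have hval : ∀ j, ∫ x, R (F^[j] x) ∂μ = ∫ x, R x ∂μ := fun j => by
    have := (hF.iterate j).map_eq
    conv_rhs => rw [← this]
    rw [integral_map (hF.iterate j).measurable.aemeasurable (by rw [this]; exact hR.1)]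
  have hI : 0 ≤ ∫ x, R x ∂μ := integral_nonneg hR0
  have hsum : Summable fun n : ℕ => (∫ x, R x ∂μ) * (v / w) ^ n :=
    (summable_geometric_of_lt_one (by positivity) ((div_lt_one hw).2 hvw)).mul_left _
  -- By invariance the sum has mean N n ∫R ≤ v^n ∫R, so Markov's inequality bounds the exceptional
  -- set by (v/w)^n ∫R; no pointwise ergodic theorem is needed.
  have := ae_eventually_notMem_of_summable (μ := μ)
    (s := fun n => {x | w ^ n ≤ ∑ j ∈ Finset.range (N n), R (F^[j] x)}) hsum (by
      filter_upwards [hN] with n hn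
      have hM := mul_meas_ge_le_integral_of_nonneg (μ := μ)
        (f := fun x => ∑ j ∈ Finset.range (N n), R (F^[j] x))
        (Eventually.of_forall fun x => Finset.sum_nonneg fun j _ => hR0 _)
        (integrable_finsetSum _ fun j _ => hint j) (w ^ n)
      rw [integral_finsetSum _ fun j _ => hint j, Finset.sum_congr rfl fun j _ => hval j,
        Finset.sum_const, Finset.card_range, nsmul_eq_mul] at hM
      rw [div_pow, mul_div_assoc', le_div_iff₀ (by positivity), mul_comm]
      refine hM.trans ?_
      rw [mul_comm]
      gcongr)
  filter_upwards [this] with x hx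
  filter_upwards [hx] with n hn
  exact (not_le.1 hn).le

variable {Y : Type*} [MetricSpace Y] [MeasurableSpace Y] [BorelSpace Y] {F : Y → Y}
  {μ : Measure Y} [IsProbabilityMeasure μ] {A : Type*} [MeasurableSpace A] [Countable A]
  [DiscreteMeasurableSpace A] {P : A → Set ℝ} {g : ℝ → ℝ} {ι : Y → ℝ}

omit [BorelSpace Y] [Countable A] [DiscreteMeasurableSpace A] [IsProbabilityMeasure μ] in
theorem IsGibbsMarkov.minBall_le (H : IsGibbsMarkov F μ P g ι) [BorelSpace Y] (y : Y) (r : ℝ) :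
    minBall μ r ≤ μ (Metric.ball y r) :=
  iInf₂_le y (H.support_eq_univ ▸ Set.mem_univ y)

omit [Countable A] [DiscreteMeasurableSpace A] in
theorem IsGibbsMarkov.upperMinkowskiDim_nonneg (H : IsGibbsMarkov F μ P g ι) :
    0 ≤ upperMinkowskiDim μ := by
  by_contra! hlt
  obtain ⟨β, h₁, h₂⟩ := EReal.lt_iff_exists_real_btwn.1 hlt
  obtain ⟨y⟩ : Nonempty Y := nonempty_of_isProbabilityMeasure μ
  obtain ⟨r, hr, hr0, hr1⟩ := ((eventually_lt_minBall h₁).and eventually_mem_Ioo_zero_one).exists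
  have h₃ := (hr.trans_le (H.minBall_le y r)).trans_le prob_le_one
  rw [ENNReal.ofReal_lt_one] at h₃
  exact absurd h₃ (not_lt.2
    (Real.one_le_rpow_of_pos_of_le_one_of_nonpos hr0 hr1.le (EReal.coe_neg'.1 h₂).le))

theorem tendsto_inv_two_pow : Tendsto (fun n : ℕ => ((2 : ℝ) ^ n)⁻¹) atTop (𝓝[>] 0) :=
  tendsto_nhdsWithin_iff.2
    ⟨(tendsto_pow_atTop_atTop_of_one_lt one_lt_two).inv_tendsto_atTop,
      Eventually.of_forall fun n => by simp⟩

/-- For almost every point of a Gibbs–Markov system, the orbit segment of length `2 ^ (b n)` is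
`4 * 2 ^ (-n)`-dense for all large `n`, as soon as `b` exceeds the upper Minkowski dimension. -/
theorem IsGibbsMarkov.ae_orbit_dense (H : IsGibbsMarkov F μ P g ι) {b : ℝ}
    (hb : upperMinkowskiDim μ < b) :
    ∀ᵐ y ∂μ, ∀ᶠ n : ℕ in atTop, ∀ z : Y, ∃ j : ℕ, (j : ℝ) + 1 ≤ ((2 : ℝ) ^ b) ^ n ∧
      dist (F^[j] y) z < 4 * ((2 : ℝ) ^ n)⁻¹ := by
  obtain ⟨β, hβ, hβb⟩ : ∃ β : ℝ, upperMinkowskiDim μ < β ∧ β < b := by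
    obtain ⟨β, h₁, h₂⟩ := EReal.lt_iff_exists_real_btwn.1 hb
    exact ⟨β, h₁, EReal.coe_lt_coe_iff.1 h₂⟩
  have hβ0 : 0 < β := by
    exact EReal.coe_pos.1 (lt_of_le_of_lt H.upperMinkowskiDim_nonneg hβ)
  -- Three rates: β for the ball masses, s for the number of blocks, b for the total length. The gap
  -- s - β makes avoidance super-exponentially unlikely, and b - s absorbs the block length, linear
  -- in `n`.
  set s := (β + b) / 2 with hs
  have hβs : β < s := by rw [hs]; linarith
  have hsb : s < b := by rw [hs]; linarith
  obtain ⟨N₀, c, D, γ, hc, hD, hγ, havoid⟩ := H.exists_avoid_ball_le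
  obtain ⟨a, ha⟩ := pow_unbounded_of_one_lt 2 hγ
  obtain ⟨e, he⟩ := pow_unbounded_of_one_lt D hγ
  have hγ0 : 0 < γ := one_pos.trans hγ
  -- As γ^a > 2 and γ^e > D, itineraries of this length determine points up to 2^(-n).
  set q : ℕ → ℕ := fun n => a * n + (e + 1) with hq
  set k : ℕ → ℕ := fun n => ⌈((2 : ℝ) ^ s) ^ n⌉₊ with hk
  have hqρ : ∀ n, D / γ ^ q n < ((2 : ℝ) ^ n)⁻¹ := by
    intro n
    rw [div_lt_iff₀ (by positivity), ← div_eq_inv_mul, lt_div_iff₀ (by positivity), mul_comm]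
    calc (2 : ℝ) ^ n * D < (2 : ℝ) ^ n * γ ^ (e + 1) := by
          gcongr
          exact he.trans (pow_lt_pow_right₀ hγ (by omega))
      _ ≤ (γ ^ a) ^ n * γ ^ (e + 1) := by gcongr
      _ = γ ^ q n := by rw [← pow_mul, ← pow_add]
  have hlen : ∀ᶠ n in atTop, (((2 + k n * (q n + N₀) : ℕ)) : ℝ) + 1 ≤ ((2 : ℝ) ^ b) ^ n := by
    have hlim : Tendsto (fun n : ℕ => ((n : ℝ) ^ 1) / ((2 : ℝ) ^ (b - s)) ^ n) atTop (𝓝 0) :=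
      tendsto_pow_const_div_const_pow_of_one_lt 1
        (Real.one_lt_rpow one_lt_two (by linarith))
    have hC : (0 : ℝ) < 2 * (a + (e + 1) + N₀) + 3 := by positivity
    filter_upwards [hlim.eventually (gt_mem_nhds (inv_pos.2 hC)), eventually_ge_atTop 1]
      with n hn hn1
    have hn1' : (1 : ℝ) ≤ n := by exact_mod_cast hn1
    have hS : (1 : ℝ) ≤ ((2 : ℝ) ^ s) ^ n :=
      one_le_pow₀ (Real.one_le_rpow one_le_two (by linarith))
    have hU : (0 : ℝ) < ((2 : ℝ) ^ (b - s)) ^ n := by positivity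
    rw [pow_one, div_lt_iff₀ hU, ← div_eq_inv_mul, lt_div_iff₀ hC] at hn
    have hkn : (k n : ℝ) ≤ 2 * ((2 : ℝ) ^ s) ^ n := by
      have := (Nat.ceil_lt_add_one (zero_le_one.trans hS)).le
      linarith
    have hqn : ((q n + N₀ : ℕ) : ℝ) ≤ n * (a + (e + 1) + N₀) := by
      simp only [hq]
      push_cast
      nlinarith [(Nat.cast_nonneg a : (0 : ℝ) ≤ a), (Nat.cast_nonneg e : (0 : ℝ) ≤ e),
        (Nat.cast_nonneg N₀ : (0 : ℝ) ≤ N₀)]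
    calc (((2 + k n * (q n + N₀) : ℕ)) : ℝ) + 1 = 3 + k n * ((q n + N₀ : ℕ) : ℝ) := by
          push_cast; ring
      _ ≤ 3 * (((2 : ℝ) ^ s) ^ n * n) +
          (2 * ((2 : ℝ) ^ s) ^ n) * (n * (a + (e + 1) + N₀)) := by
        gcongr
        nlinarith
      _ = ((2 : ℝ) ^ s) ^ n * (n * (2 * (a + (e + 1) + N₀) + 3)) := by ring
      _ ≤ ((2 : ℝ) ^ s) ^ n * ((2 : ℝ) ^ (b - s)) ^ n := by gcongr
      _ = ((2 : ℝ) ^ b) ^ n := by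
        rw [← mul_pow, ← Real.rpow_add two_pos, add_sub_cancel]
  have hball : ∀ᶠ n : ℕ in atTop, ∀ y,
      (((2 : ℝ) ^ β) ^ n)⁻¹ ≤ μ.real (Metric.ball y ((2 : ℝ) ^ n)⁻¹) := by
    filter_upwards [tendsto_inv_two_pow.eventually (eventually_lt_minBall hβ)] with n hn y
    have h₁ := ENNReal.toReal_mono (measure_ne_top _ _) (hn.le.trans (H.minBall_le y _))
    rwa [ENNReal.toReal_ofReal (by positivity), Real.inv_rpow (by positivity),
      ← Real.rpow_natCast_mul two_pos.le, mul_comm, Real.rpow_mul_natCast two_pos.le] at h₁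
  have hsum : Summable fun n : ℕ =>
      ((2 : ℝ) ^ β) ^ n * Real.exp (-(c * ((2 : ℝ) ^ (s - β)) ^ n)) :=
    summable_pow_mul_exp_neg_mul_pow (Real.one_lt_rpow one_lt_two (by linarith))
      (by positivity) hc
  -- Union bound over a net of at most 2^(βn) centres. The constant 4 is 2 for the distance to the
  -- net plus 2 for the avoidance estimate.
  have hBC := ae_eventually_notMem_of_summable (μ := μ)
    (s := fun n => {y | ∃ z : Y, ∀ j < 2 + k n * (q n + N₀),
      4 * ((2 : ℝ) ^ n)⁻¹ ≤ dist (F^[j] y) z}) hsum (by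
      filter_upwards [hball] with n hn
      obtain ⟨Z, hZc, hZ⟩ := exists_net (by positivity) hn
      have hsub : {y | ∃ z : Y, ∀ j < 2 + k n * (q n + N₀),
          4 * ((2 : ℝ) ^ n)⁻¹ ≤ dist (F^[j] y) z} ⊆
          ⋃ z ∈ Z, {y | ∀ j < 2 + k n * (q n + N₀), 2 * ((2 : ℝ) ^ n)⁻¹ ≤ dist (F^[j] y) z} := by
        rintro y ⟨z, hz⟩
        obtain ⟨z', hz', hd⟩ := hZ z
        refine Set.mem_iUnion₂.2 ⟨z', hz', fun j hj => ?_⟩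
        have := dist_triangle (F^[j] y) z' z
        rw [dist_comm z' z] at this
        linarith [hz j hj]
      calc _ ≤ ∑ z ∈ Z, μ.real
            {y | ∀ j < 2 + k n * (q n + N₀), 2 * ((2 : ℝ) ^ n)⁻¹ ≤ dist (F^[j] y) z} :=
            (measureReal_mono hsub (measure_ne_top _ _)).trans (measureReal_biUnion_finset_le _ _)
        _ ≤ ∑ _z ∈ Z, Real.exp (-(c * ((2 : ℝ) ^ (s - β)) ^ n)) := by
            refine Finset.sum_le_sum fun z _ =>
              (havoid (q n) _ z (by simp only [hq]; omega) (hqρ n) (k n)).trans ?_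
            refine Real.exp_le_exp.2 (neg_le_neg ?_)
            rw [mul_assoc]
            gcongr
            calc ((2 : ℝ) ^ (s - β)) ^ n = (((2 : ℝ) ^ β) ^ n)⁻¹ * ((2 : ℝ) ^ s) ^ n := by
                  rw [Real.rpow_sub two_pos, div_pow, div_eq_inv_mul]
              _ ≤ _ := by
                  gcongr
                  · exact hn z
                  · exact Nat.le_ceil _
        _ = Z.card * Real.exp (-(c * ((2 : ℝ) ^ (s - β)) ^ n)) := by simp
        _ ≤ _ := by
            gcongr
            rwa [← div_eq_mul_inv, div_le_one (by positivity)] at hZc)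
  filter_upwards [hBC] with y hy
  filter_upwards [hy, hlen] with n hn hn' z
  simp only [not_exists, not_forall, not_le] at hn
  obtain ⟨j, hj, hd⟩ := hn z
  refine ⟨j, le_trans ?_ hn', hd⟩
  have : (j : ℝ) ≤ ((2 + k n * (q n + N₀) : ℕ) : ℝ) := by exact_mod_cast hj.le
  linarith

end SectionCover

/-! ### Growth rates along dyadic scales -/

section DyadicScales

/-- Both neighbouring scales are provided: by monotonicity the finer one bounds a cover time from
above, the coarser one from below. -/
theorem eventually_exists_dyadic {c : ℝ} (hc : 0 < c) {p : ℕ → Prop} (hp : ∀ᶠ n in atTop, p n) :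
    ∀ᶠ r : ℝ in 𝓝[>] 0, ∃ n : ℕ, p n ∧ p (n + 1) ∧ c * ((2 : ℝ) ^ (n + 1))⁻¹ ≤ r ∧
      r ≤ c * ((2 : ℝ) ^ n)⁻¹ := by
  obtain ⟨n₀, hn₀⟩ := eventually_atTop.1 hp
  filter_upwards [Ioo_mem_nhdsGT (show 0 < c * ((2 : ℝ) ^ n₀)⁻¹ by positivity)] with r hr
  have h₁ : 0 < r / c := div_pos hr.1 hc
  have h₂ : r / c < ((2 : ℝ) ^ n₀)⁻¹ := by
    rw [div_lt_iff₀ hc, mul_comm]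
    exact hr.2
  have h₃ : ((2 : ℝ) ^ n₀)⁻¹ ≤ 1 := inv_le_one_of_one_le₀ (one_le_pow₀ one_le_two)
  obtain ⟨n, hn, hn'⟩ := exists_nat_pow_near_of_lt_one h₁ (h₂.le.trans h₃)
    (show (0 : ℝ) < 1 / 2 by norm_num) (by norm_num)
  rw [one_div, inv_pow] at hn hn'
  have hle : n₀ ≤ n := by
    by_contra! hlt
    have h₄ : ((2 : ℝ) ^ n₀)⁻¹ ≤ ((2 : ℝ) ^ (n + 1))⁻¹ := by
      gcongr
      · exact one_le_two
      · omega
    linarith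
  rw [lt_div_iff₀ hc] at hn
  rw [div_le_iff₀ hc] at hn'
  exact ⟨n, hn₀ n hle, hn₀ (n + 1) (by omega), by linarith, by linarith⟩

theorem eventually_rpow_le {s C : ℝ} (hs : 0 < s) (hC : 0 < C) :
    ∀ᶠ r : ℝ in 𝓝[>] 0, r ^ s ≤ C := by
  have h : Tendsto (fun r : ℝ => r ^ s) (𝓝 0) (𝓝 0) := by
    have := (Real.continuousAt_rpow_const 0 s (Or.inr hs.le)).tendsto
    rwa [Real.zero_rpow hs.ne'] at this
  exact ((h.eventually (gt_mem_nhds hC)).filter_mono nhdsWithin_le_nhds).mono fun r hr => hr.le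

theorem pow_rpow_comm (b : ℝ) (n : ℕ) : ((2 : ℝ) ^ b) ^ n = ((2 : ℝ) ^ n) ^ b := by
  rw [← Real.rpow_mul_natCast two_pos.le, mul_comm, Real.rpow_natCast_mul two_pos.le]

/-- Passing from dyadic scales to all scales costs a constant factor, absorbed by r^(b' - b) → 0;
hence the strict loss in the exponent. -/
theorem limsup_log_div_le {u : ℝ → ℝ≥0∞} (hu : Antitone u) {b b' c : ℝ} (hb : 0 ≤ b)
    (hbb : b < b') (hc : 0 < c)
    (h : ∀ᶠ n : ℕ in atTop, u (c * ((2 : ℝ) ^ n)⁻¹) ≤ ENNReal.ofReal (((2 : ℝ) ^ b) ^ n)) :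
    limsup (fun r : ℝ => ENNReal.log (u r) / ((-Real.log r : ℝ) : EReal)) (𝓝[>] 0) ≤ b' := by
  refine limsup_le_of_le (h := ?_)
  filter_upwards [eventually_exists_dyadic hc h, eventually_mem_Ioo_zero_one,
    eventually_rpow_le (sub_pos.2 hbb) (show 0 < ((2 * c) ^ b)⁻¹ by positivity)]
    with r ⟨n, _, hn, hlo, hup⟩ ⟨hr0, hr1⟩ hr
  rw [log_div_neg_log_le_iff hr0 hr1]
  refine (hu hlo).trans (hn.trans (ENNReal.ofReal_le_ofReal ?_))
  have h₁ : (2 : ℝ) ^ (n + 1) ≤ 2 * c / r := by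
    rw [← div_eq_mul_inv, le_div_iff₀ (by positivity)] at hup
    rw [le_div_iff₀ hr0, pow_succ]
    linarith
  calc ((2 : ℝ) ^ b) ^ (n + 1) = ((2 : ℝ) ^ (n + 1)) ^ b := pow_rpow_comm b _
    _ ≤ (2 * c / r) ^ b := Real.rpow_le_rpow (by positivity) h₁ hb
    _ = (2 * c) ^ b * r ^ (b' - b) * r ^ (-b') := by
        rw [Real.div_rpow (by positivity) hr0.le, mul_assoc, ← Real.rpow_add hr0, div_eq_mul_inv,
          ← Real.rpow_neg hr0.le]
        congr 2
        ring
    _ ≤ (2 * c) ^ b * ((2 * c) ^ b)⁻¹ * r ^ (-b') := by gcongr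
    _ = r ^ (-b') := by rw [mul_inv_cancel₀ (by positivity), one_mul]

theorem le_liminf_log_div {u : ℝ → ℝ≥0∞} (hu : Antitone u) {b b' c : ℝ} (hb : 0 ≤ b)
    (hbb : b' < b) (hc : 0 < c)
    (h : ∀ᶠ n : ℕ in atTop, ENNReal.ofReal (((2 : ℝ) ^ b) ^ n) ≤ u (c * ((2 : ℝ) ^ n)⁻¹)) :
    b' ≤ liminf (fun r : ℝ => ENNReal.log (u r) / ((-Real.log r : ℝ) : EReal)) (𝓝[>] 0) := by
  refine le_liminf_of_le (h := ?_)
  filter_upwards [eventually_exists_dyadic hc h, eventually_mem_Ioo_zero_one,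
    eventually_rpow_le (sub_pos.2 hbb) (show 0 < (c / 2) ^ b by positivity)]
    with r ⟨n, hn, _, hlo, hup⟩ ⟨hr0, hr1⟩ hr
  rw [le_log_div_neg_log_iff hr0 hr1]
  refine le_trans (ENNReal.ofReal_le_ofReal ?_) (hn.trans (hu hup))
  have h₁ : c / 2 / r ≤ (2 : ℝ) ^ n := by
    rw [← div_eq_mul_inv, div_le_iff₀ (by positivity), pow_succ] at hlo
    rw [div_le_iff₀ hr0]
    linarith
  calc r ^ (-b') = r ^ (b - b') * r ^ (-b) := by
        rw [← Real.rpow_add hr0]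
        congr 1
        ring
    _ ≤ (c / 2) ^ b * r ^ (-b) := by gcongr
    _ = (c / 2 / r) ^ b := by
        rw [Real.div_rpow (by positivity) hr0.le, Real.rpow_neg hr0.le, ← div_eq_mul_inv]
    _ ≤ ((2 : ℝ) ^ n) ^ b := Real.rpow_le_rpow (by positivity) h₁ hb
    _ = ((2 : ℝ) ^ b) ^ n := (pow_rpow_comm b n).symm

end DyadicScales

/-! ### Lower bound for cover times of semiflows of bounded speed -/

section LowerBound

variable {X : Type*} {f : ℝ≥0 → X → X}

theorem nonwanderingSet_eq_univ [TopologicalSpace X] (h : IsTopologicallyMixing f) :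
    nonwanderingSet f = Set.univ := by
  refine Set.eq_univ_of_forall fun x U hU hx T => ?_
  obtain ⟨T', hT'⟩ := h U U hU hU ⟨x, hx⟩ ⟨x, hx⟩
  exact ⟨max T T', le_max_left _ _, hT' _ (le_max_right _ _)⟩

theorem flowCoverTime_antitone [PseudoMetricSpace X] (x : X) :
    Antitone fun r => flowCoverTime f r x := by
  intro r r' hr
  refine le_iInf₂ fun T hT => iInf₂_le T ⟨hT.1, fun y hy => ?_⟩
  obtain ⟨t, ht, hd⟩ := hT.2 y hy
  exact ⟨t, ht, hd.trans_le hr⟩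

theorem exists_dist_lt_of_flowCoverTime_lt [PseudoMetricSpace X] {r : ℝ} {x : X} {T : ℝ}
    (h : flowCoverTime f r x < ENNReal.ofReal T) :
    ∃ T' : ℝ≥0, (T' : ℝ) < T ∧ ∀ y ∈ nonwanderingSet f, ∃ t ≤ T', dist (f t x) y < r := by
  obtain ⟨T', h⟩ := iInf_lt_iff.1 h
  obtain ⟨hT', hlt⟩ := iInf_lt_iff.1 h
  refine ⟨T', ?_, hT'.2⟩
  rwa [ENNReal.ofReal, ENNReal.coe_lt_coe, Real.lt_toNNReal_iff_coe_lt] at hlt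

theorem dist_flow_le [PseudoMetricSpace X] {K : ℝ}
    (hspeed : ∀ (x : X) (s t : ℝ≥0), 0 < t → dist (f s x) (f (s + t) x) < K * t)
    (x : X) (s t : ℝ≥0) : dist (f s x) (f t x) ≤ K * dist s t := by
  have key : ∀ s t : ℝ≥0, s < t → dist (f s x) (f t x) ≤ K * dist s t := by
    intro s t hst
    have h := (hspeed x s (t - s) (tsub_pos_of_lt hst)).le
    rw [add_tsub_cancel_of_le hst.le, NNReal.coe_sub hst.le] at h
    refine h.trans_eq ?_
    rw [dist_comm, NNReal.dist_eq, abs_of_nonneg (sub_nonneg.2 (NNReal.coe_le_coe.2 hst.le))]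
  rcases lt_trichotomy s t with hst | rfl | hst
  · exact key s t hst
  · simp
  · rw [dist_comm, dist_comm s]
    exact key t s hst

/-- The orbit must come close to two distinct points, and bounded speed makes the trip between them
take a definite time. This settles negative growth exponents. -/
theorem eventually_flowCoverTime_ge [MetricSpace X] (hspeed : HasBoundedSpeed f)
    (hΩ : nonwanderingSet f = Set.univ) [Nontrivial X] :
    ∃ c : ℝ, 0 < c ∧ ∀ᶠ r : ℝ in 𝓝[>] 0, ∀ x, ENNReal.ofReal c ≤ flowCoverTime f r x := by
  obtain ⟨K, hK, hspeed⟩ := hspeed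
  obtain ⟨p, q, hpq⟩ := exists_pair_ne X
  have hD : 0 < dist p q := dist_pos.2 hpq
  refine ⟨dist p q / (2 * K), by positivity, ?_⟩
  filter_upwards [Ioo_mem_nhdsGT (show 0 < dist p q / 4 by positivity)] with r hr x
  by_contra! hlt
  obtain ⟨T, hT, hcov⟩ := exists_dist_lt_of_flowCoverTime_lt hlt
  obtain ⟨s, hs, hsp⟩ := hcov p (hΩ ▸ Set.mem_univ p)
  obtain ⟨t, ht, htq⟩ := hcov q (hΩ ▸ Set.mem_univ q)
  have hst : dist s t ≤ T := by
    rw [NNReal.dist_eq, abs_sub_le_iff]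
    have h₁ : (s : ℝ) ≤ T := hs
    have h₂ : (t : ℝ) ≤ T := ht
    constructor <;> linarith [NNReal.coe_nonneg s, NNReal.coe_nonneg t]
  have h₁ := dist_flow_le hspeed x s t
  have h₂ := dist_triangle4 p (f s x) (f t x) q
  rw [dist_comm p (f s x)] at h₂
  have h₃ : K * dist s t ≤ K * T := by gcongr
  rw [lt_div_iff₀ (by positivity)] at hT
  linarith [hr.2]

variable [MetricSpace X] [MeasurableSpace X] [BorelSpace X] {ν : Measure X}
  [IsProbabilityMeasure ν]

/-- The set of points whose orbit visits a ball of radius `ρ` before time `T` is covered by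
discretely many preimages of the ball of twice the radius. -/
theorem measureReal_flowCoverTime_lt_le (hinv : ∀ t, MeasurePreserving (f t) ν ν) {K : ℝ}
    (hK : 0 < K) (hspeed : ∀ (x : X) (s t : ℝ≥0), 0 < t → dist (f s x) (f (s + t) x) < K * t)
    {z : X} (hz : z ∈ nonwanderingSet f) {ρ T : ℝ} (hρ : 0 < ρ) (hT : 0 ≤ T) :
    ν.real {x | flowCoverTime f ρ x < ENNReal.ofReal T} ≤
      (T * K / ρ + 2) * ν.real (Metric.ball z (2 * ρ)) := by
  -- Within time δ a point moves at most ρ. The first grid time strictly after a visit is at most δ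
  -- later, so it still finds the orbit in the doubled ball.
  set δ : ℝ≥0 := ⟨ρ / K, by positivity⟩ with hδ
  have hδρ : (δ : ℝ) = ρ / K := rfl
  have hsub : {x | flowCoverTime f ρ x < ENNReal.ofReal T} ⊆
      ⋃ k ∈ Finset.range (⌊T * K / ρ⌋₊ + 2), f (k * δ) ⁻¹' Metric.ball z (2 * ρ) := by
    intro x hx
    obtain ⟨T', hT', hcov⟩ := exists_dist_lt_of_flowCoverTime_lt hx
    obtain ⟨t, ht, hd⟩ := hcov z hz
    have htT : (t : ℝ) ≤ T := (NNReal.coe_le_coe.2 ht).trans hT'.le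
    refine Set.mem_iUnion₂.2 ⟨⌊t * K / ρ⌋₊ + 1, ?_, ?_⟩
    · rw [Finset.mem_range]
      have : ⌊t * K / ρ⌋₊ ≤ ⌊T * K / ρ⌋₊ := Nat.floor_le_floor (by gcongr)
      omega
    · have h₁ := Nat.lt_floor_add_one (t * K / ρ)
      have h₂ := Nat.floor_le (show 0 ≤ t * K / ρ by positivity)
      set k := ⌊t * K / ρ⌋₊
      rw [div_lt_iff₀ hρ] at h₁
      rw [le_div_iff₀ hρ] at h₂
      have h₃ : (t : ℝ) < (((k + 1 : ℕ) : ℝ≥0) * δ : ℝ≥0) := by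
        push_cast
        rw [hδρ, mul_div_assoc', lt_div_iff₀ hK]
        exact h₁
      have h₄ : ((((k + 1 : ℕ) : ℝ≥0) * δ : ℝ≥0) : ℝ) - t ≤ ρ / K := by
        push_cast
        rw [hδρ, sub_le_iff_le_add, mul_div_assoc', div_le_iff₀ hK, add_mul, add_mul,
          div_mul_cancel₀ _ hK.ne']
        linarith
      have h₅ := dist_flow_le hspeed x (((k + 1 : ℕ) : ℝ≥0) * δ) t
      rw [NNReal.dist_eq, abs_of_pos (sub_pos.2 h₃)] at h₅
      have h₆ : K * (((((k + 1 : ℕ) : ℝ≥0) * δ : ℝ≥0) : ℝ) - t) ≤ ρ := by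
        rw [mul_comm]
        exact (le_div_iff₀ hK).1 h₄
      have h₇ := dist_triangle (f (((k + 1 : ℕ) : ℝ≥0) * δ) x) (f t x) z
      change dist _ _ < _
      linarith
  calc _ ≤ ∑ k ∈ Finset.range (⌊T * K / ρ⌋₊ + 2),
        ν.real (f (k * δ) ⁻¹' Metric.ball z (2 * ρ)) :=
        (measureReal_mono hsub (measure_ne_top _ _)).trans (measureReal_biUnion_finset_le _ _)
    _ = ∑ _k ∈ Finset.range (⌊T * K / ρ⌋₊ + 2), ν.real (Metric.ball z (2 * ρ)) :=
        Finset.sum_congr rfl fun k _ => (hinv _).measureReal_preimage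
          Metric.isOpen_ball.measurableSet.nullMeasurableSet
    _ = (⌊T * K / ρ⌋₊ + 2 : ℝ) * ν.real (Metric.ball z (2 * ρ)) := by simp
    _ ≤ _ := by
        gcongr
        exact Nat.floor_le (by positivity)

theorem ae_le_liminf_of_lt_lowerMinkowskiDim (hinv : ∀ t, MeasurePreserving (f t) ν ν)
    (hspeed : HasBoundedSpeed f) (hΩ : nonwanderingSet f = Set.univ) {b α : ℝ} (hb : 0 ≤ b)
    (hbα : b + 1 < α) (hα : α < lowerMinkowskiDim ν) :
    ∀ᵐ x ∂ν, (b : EReal) ≤ liminf (fun r : ℝ => ENNReal.log (flowCoverTime f r x) /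
      ((-Real.log r : ℝ) : EReal)) (𝓝[>] 0) := by
  obtain ⟨K, hK, hspeed⟩ := hspeed
  -- Below α - 1 the probabilities are summable; above `b` there is room to interpolate between
  -- dyadic scales.
  obtain ⟨b₁, hbb₁, hb₁⟩ := exists_between (show b < α - 1 by linarith)
  have hlt : (2 : ℝ) ^ (b₁ + 1 - α) < 1 := Real.rpow_lt_one_of_one_lt_of_neg one_lt_two (by linarith)
  have hsum : Summable fun n : ℕ => (2 * K + 2) * ((2 : ℝ) ^ (b₁ + 1 - α)) ^ n :=
    (summable_geometric_of_lt_one (by positivity) hlt).mul_left _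
  have hBC := ae_eventually_notMem_of_summable (μ := ν) (s := fun n : ℕ =>
    {x | flowCoverTime f (1 / 2 * ((2 : ℝ) ^ n)⁻¹) x < ENNReal.ofReal (((2 : ℝ) ^ b₁) ^ n)}) hsum (by
      filter_upwards [tendsto_inv_two_pow.eventually (eventually_minBall_lt hα)] with n hn
      obtain ⟨z, hn⟩ := iInf_lt_iff.1 hn
      obtain ⟨-, hz⟩ := iInf_lt_iff.1 hn
      have hz' : ν.real (Metric.ball z ((2 : ℝ) ^ n)⁻¹) ≤ (((2 : ℝ) ^ α) ^ n)⁻¹ := by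
        have := ENNReal.toReal_mono ENNReal.ofReal_ne_top hz.le
        rwa [ENNReal.toReal_ofReal (by positivity), Real.inv_rpow (by positivity),
          ← pow_rpow_comm] at this
      have h := measureReal_flowCoverTime_lt_le hinv hK hspeed (z := z) (hΩ ▸ Set.mem_univ z)
        (ρ := 1 / 2 * ((2 : ℝ) ^ n)⁻¹) (T := ((2 : ℝ) ^ b₁) ^ n) (by positivity) (by positivity)
      refine h.trans ?_
      rw [show 2 * (1 / 2 * ((2 : ℝ) ^ n)⁻¹) = ((2 : ℝ) ^ n)⁻¹ by ring]
      -- Nonnegative exponents allow the additive 2 in the count of grid times to be absorbed.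
      have h₁ : (1 : ℝ) ≤ ((2 : ℝ) ^ b₁) ^ n * 2 ^ n :=
        one_le_mul_of_one_le_of_one_le
          (one_le_pow₀ (Real.one_le_rpow one_le_two (by linarith))) (one_le_pow₀ one_le_two)
      calc (((2 : ℝ) ^ b₁) ^ n * K / (1 / 2 * ((2 : ℝ) ^ n)⁻¹) + 2) *
            ν.real (Metric.ball z ((2 : ℝ) ^ n)⁻¹)
          ≤ (2 * K * (((2 : ℝ) ^ b₁) ^ n * 2 ^ n) + 2 * (((2 : ℝ) ^ b₁) ^ n * 2 ^ n)) *
            (((2 : ℝ) ^ α) ^ n)⁻¹ := by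
            gcongr
            · refine le_of_eq ?_
              field_simp
            · linarith
        _ = (2 * K + 2) * ((2 : ℝ) ^ (b₁ + 1 - α)) ^ n := by
            rw [Real.rpow_sub two_pos, Real.rpow_add two_pos, Real.rpow_one, div_pow, mul_pow]
            ring)
  filter_upwards [hBC] with x hx
  refine le_liminf_log_div (flowCoverTime_antitone x) (hb.trans hbb₁.le) hbb₁
    (show (0 : ℝ) < 1 / 2 by norm_num) ?_
  filter_upwards [hx] with n hn
  exact not_lt.1 hn

/-- Almost surely the growth rate of the cover time is at least the lower Minkowski dimension of
the invariant measure minus one. -/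
theorem ae_lowerMinkowskiDim_sub_one_le (hinv : ∀ t, MeasurePreserving (f t) ν ν)
    (hspeed : HasBoundedSpeed f) (hΩ : nonwanderingSet f = Set.univ) [Nontrivial X] :
    ∀ᵐ x ∂ν, lowerMinkowskiDim ν - 1 ≤ liminf (fun r : ℝ =>
      ENNReal.log (flowCoverTime f r x) / ((-Real.log r : ℝ) : EReal)) (𝓝[>] 0) := by
  -- Rational exponents leave only countably many null sets.
  have key : ∀ b : ℚ, ((b : ℝ) : EReal) < lowerMinkowskiDim ν - 1 → ∀ᵐ x ∂ν, ((b : ℝ) : EReal) ≤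
      liminf (fun r : ℝ => ENNReal.log (flowCoverTime f r x) / ((-Real.log r : ℝ) : EReal))
        (𝓝[>] 0) := by
    intro b hb
    rcases le_or_gt 0 (b : ℝ) with hb0 | hb0
    · have hb' : (((b : ℝ) + 1 : ℝ) : EReal) < lowerMinkowskiDim ν := by
        rw [EReal.coe_add, EReal.coe_one]
        exact EReal.add_lt_of_lt_sub hb
      obtain ⟨α, h₁, h₂⟩ := EReal.lt_iff_exists_real_btwn.1 hb'
      exact ae_le_liminf_of_lt_lowerMinkowskiDim hinv hspeed hΩ hb0 (EReal.coe_lt_coe_iff.1 h₁) h₂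
    · obtain ⟨c, hc, h⟩ := eventually_flowCoverTime_ge hspeed hΩ
      refine Eventually.of_forall fun x => le_liminf_of_le (h := ?_)
      filter_upwards [h, eventually_mem_Ioo_zero_one, eventually_rpow_le (neg_pos.2 hb0) hc]
        with r hr hr01 hrc
      rw [le_log_div_neg_log_iff hr01.1 hr01.2]
      exact (ENNReal.ofReal_le_ofReal hrc).trans (hr x)
  have hall : ∀ᵐ x ∂ν, ∀ b : ℚ, ((b : ℝ) : EReal) < lowerMinkowskiDim ν - 1 → ((b : ℝ) : EReal) ≤
      liminf (fun r : ℝ => ENNReal.log (flowCoverTime f r x) / ((-Real.log r : ℝ) : EReal))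
        (𝓝[>] 0) := by
    rw [ae_all_iff]
    intro b
    by_cases hb : ((b : ℝ) : EReal) < lowerMinkowskiDim ν - 1
    · filter_upwards [key b hb] with x hx _ using hx
    · exact Eventually.of_forall fun x h => absurd h hb
  filter_upwards [hall] with x hx
  by_contra! hlt
  obtain ⟨b, h₁, h₂⟩ := EReal.lt_iff_exists_rat_btwn.1 hlt
  exact absurd (hx b h₂) (not_le.2 h₁)

end LowerBound

/-! ### Upper bound for cover times through the section -/

section UpperBound

theorem coe_iterate_poincareMap {X : Type*} {f : ℝ≥0 → X → X} (hf : IsSemiflow f) {Y : Set X}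
    (hY : IsPoincareSection f Y) (y : Y) (k : ℕ) :
    (((poincareMap f Y hY)^[k] y : Y) : X) =
      f (∑ j ∈ Finset.range k, hittingTime f Y ((poincareMap f Y hY)^[j] y : Y)) y := by
  induction k with
  | zero => simp [hf.zero]
  | succ k ih =>
    rw [Function.iterate_succ_apply', Finset.sum_range_succ, add_comm, hf.add, ← ih]
    rfl

/-- In a space with at most one point all the quotients are 0/0 = 0. -/
theorem nontrivial_of_distortion_pos {X : Type*} [MetricSpace X] {f : ℝ≥0 → X → X} {Y : Set X}
    {ι : Y → ℝ} {T₁ : ℝ≥0} (h : 0 < distortion f Y ι T₁) : Nontrivial X := by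
  by_contra hX
  rw [not_nontrivial_iff_subsingleton] at hX
  refine h.ne' ?_
  simp [distortion, Metric.ediam_subsingleton Set.subsingleton_of_subsingleton]

/-- Bounded distortion on intervals makes the time maps uniformly Lipschitz on the section. -/
theorem exists_lipschitzWith_of_distortion {X : Type*} [MetricSpace X] {f : ℝ≥0 → X → X}
    {Y : Set X} {ι : Y → ℝ} {L : ℝ≥0} (hL : LipschitzWith L ι) (hL' : AntilipschitzWith L ι)
    {T₁ : ℝ≥0} (h : distortion f Y ι T₁ < ⊤) :
    ∃ C : ℝ≥0, ∀ t, 0 < t → t ≤ T₁ → LipschitzWith C fun y : Y => f t y := by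
  refine ⟨(distortion f Y ι T₁).toNNReal * (L * L), fun t ht htT y z => ?_⟩
  rcases eq_or_ne y z with rfl | hyz
  · simp
  -- The smallest coordinate interval through both points. Its preimage has diameter at most L²
  -- times their distance, and a nonzero one, so the distortion quotient can be cleared.
  set J := Set.uIcc (ι y) (ι z) with hJ
  have hyJ : y ∈ ι ⁻¹' J := Set.left_mem_uIcc
  have hzJ : z ∈ ι ⁻¹' J := Set.right_mem_uIcc
  have hle : Metric.ediam ((fun y : Y => f t y) '' (ι ⁻¹' J)) / Metric.ediam (ι ⁻¹' J) ≤
      distortion f Y ι T₁ :=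
    le_iSup_of_le J (le_iSup_of_le Set.ordConnected_uIcc (le_iSup_of_le t
      (le_iSup_of_le ⟨ht, htT⟩ le_rfl)))
  have hdiam : Metric.ediam (ι ⁻¹' J) ≤ L * L * edist y z := by
    refine Metric.ediam_le fun a ha b hb => (hL' a b).trans ?_
    rw [mul_assoc]
    gcongr
    refine le_trans ?_ (hL y z)
    rw [edist_dist, edist_dist]
    refine ENNReal.ofReal_le_ofReal ?_
    rw [dist_comm (ι y)]
    exact (Real.dist_le_of_mem_uIcc ha hb).trans_eq (dist_comm _ _)
  have hpos : Metric.ediam (ι ⁻¹' J) ≠ 0 := fun h0 => by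
    have := Metric.edist_le_ediam_of_mem hyJ hzJ
    rw [h0, nonpos_iff_eq_zero, edist_eq_zero] at this
    exact hyz this
  have hfin : Metric.ediam (ι ⁻¹' J) ≠ ⊤ :=
    (hdiam.trans_lt (ENNReal.mul_lt_top (by finiteness) (edist_lt_top _ _))).ne
  rw [ENNReal.div_le_iff hpos hfin] at hle
  calc edist (f t y) (f t z) ≤ Metric.ediam ((fun y : Y => f t y) '' (ι ⁻¹' J)) :=
        Metric.edist_le_ediam_of_mem (Set.mem_image_of_mem _ hyJ) (Set.mem_image_of_mem _ hzJ)
    _ ≤ distortion f Y ι T₁ * (L * L * edist y z) := hle.trans (by gcongr)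
    _ = _ := by
        rw [ENNReal.coe_mul, ENNReal.coe_toNNReal h.ne, ENNReal.coe_mul]
        ring

theorem eventually_add_le_pow (C : ℝ) {v w : ℝ} (hv : 1 < v) (hvw : v < w) :
    ∀ᶠ n : ℕ in atTop, C + v ^ n ≤ w ^ n := by
  have hr : 1 < w / v := (one_lt_div (one_pos.trans hv)).2 hvw
  filter_upwards [(tendsto_pow_atTop_atTop_of_one_lt hr).eventually_ge_atTop (|C| + 1)] with n hn
  have hv0 : 0 < v := one_pos.trans hv
  have h₁ : 1 ≤ v ^ n := one_le_pow₀ hv.le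
  rw [div_pow, le_div_iff₀ (by positivity)] at hn
  have h₂ : |C| * 1 ≤ |C| * v ^ n := by gcongr
  linarith [le_abs_self C]

/-- If the section sweeps out the space then, along almost every orbit started on the section, the
segment of length `2 ^ (b n)` is `C * 2 ^ (-n)`-dense for all large `n`. -/
theorem ae_section_orbit_dense {X : Type*} [MetricSpace X] [MeasurableSpace X] [BorelSpace X]
    {f : ℝ≥0 → X → X} (hf : IsSemiflow f) {Y : Set X} (hY : IsPoincareSection f Y)
    {μ : Measure Y} [IsProbabilityMeasure μ]
    (hint : Integrable (fun y : Y => (hittingTime f Y y : ℝ)) μ)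
    {A : Type*} [Countable A] [MeasurableSpace A] [DiscreteMeasurableSpace A]
    {P : A → Set ℝ} {g : ℝ → ℝ} {ι : Y → ℝ} (H : IsGibbsMarkov (poincareMap f Y hY) μ P g ι)
    {T₁ : ℝ≥0} (hsweep : (⋃ (t : ℝ≥0) (_ : 0 < t ∧ t ≤ T₁), f t '' Y) = Set.univ)
    {C : ℝ≥0} (hC : ∀ t, 0 < t → t ≤ T₁ → LipschitzWith C fun y : Y => f t y)
    {b : ℝ} (hb : upperMinkowskiDim μ < b) :
    ∀ᵐ y : Y ∂μ, ∀ᶠ n : ℕ in atTop, ∀ x : X, ∃ t : ℝ≥0, (t : ℝ) ≤ ((2 : ℝ) ^ b) ^ n ∧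
      dist (f t y) x < 4 * (C + 1) * ((2 : ℝ) ^ n)⁻¹ := by
  obtain ⟨b₁, hb₁, hb₁b⟩ : ∃ b₁ : ℝ, upperMinkowskiDim μ < b₁ ∧ b₁ < b := by
    obtain ⟨β, h₁, h₂⟩ := EReal.lt_iff_exists_real_btwn.1 hb
    exact ⟨β, h₁, EReal.coe_lt_coe_iff.1 h₂⟩
  have hb₁0 : 0 < b₁ := EReal.coe_pos.1 (H.upperMinkowskiDim_nonneg.trans_lt hb₁)
  -- The rate b₁ counts iterates of the Poincaré map, b₂ bounds the sum of their return times, and b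
  -- leaves room for the additional time T₁.
  obtain ⟨b₂, hb₁₂, hb₂b⟩ := exists_between hb₁b
  set F := poincareMap f Y hY with hF
  set N : ℕ → ℕ := fun n => ⌊((2 : ℝ) ^ b₁) ^ n⌋₊ with hN
  have hpow : ∀ {s t : ℝ}, s < t → (2 : ℝ) ^ s < (2 : ℝ) ^ t := fun h =>
    Real.rpow_lt_rpow_of_exponent_lt one_lt_two h
  have hsum := ae_eventually_sum_iterate_le H.measurePreserving hint (fun y => NNReal.coe_nonneg _)
    (N := N) (by positivity) (hpow hb₁₂)
    (Eventually.of_forall fun n => Nat.floor_le (by positivity))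
  filter_upwards [hsum, H.ae_orbit_dense hb₁] with y hy₁ hy₂
  filter_upwards [hy₁, hy₂, eventually_add_le_pow T₁
    (Real.one_lt_rpow one_lt_two (hb₁0.trans hb₁₂)) (hpow hb₂b)] with n hn₁ hn₂ hn₃ x
  obtain ⟨t, ⟨ht, htT⟩, z, hz, rfl⟩ : ∃ t, (0 < t ∧ t ≤ T₁) ∧ ∃ z ∈ Y, f t z = x := by
    have : x ∈ ⋃ (t : ℝ≥0) (_ : 0 < t ∧ t ≤ T₁), f t '' Y := hsweep ▸ Set.mem_univ x
    simpa only [Set.mem_iUnion, exists_prop, Set.mem_image] using this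
  obtain ⟨j, hj, hd⟩ := hn₂ ⟨z, hz⟩
  -- Flow to the return close to `z`, then for the time `t` that carries `z` to the target. The 1 in
  -- C + 1 keeps the final inequality strict.
  refine ⟨t + ∑ i ∈ Finset.range j, hittingTime f Y (F^[i] y : Y), ?_, ?_⟩
  · have hjN : j ≤ N n := Nat.le_floor (by linarith)
    have hmono : ∑ i ∈ Finset.range j, (hittingTime f Y (F^[i] y : Y) : ℝ) ≤
        ∑ i ∈ Finset.range (N n), (hittingTime f Y (F^[i] y : Y) : ℝ) :=
      Finset.sum_le_sum_of_subset_of_nonneg (Finset.range_mono hjN)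
        fun _ _ _ => NNReal.coe_nonneg _
    have htT' : (t : ℝ) ≤ T₁ := htT
    push_cast
    linarith
  · rw [hf.add, ← coe_iterate_poincareMap hf hY]
    have h₁ := (hC t ht htT).dist_le_mul (F^[j] y) ⟨z, hz⟩
    have h₂ : (C : ℝ) * dist (F^[j] y) ⟨z, hz⟩ ≤ C * (4 * ((2 : ℝ) ^ n)⁻¹) := by gcongr
    have h₃ : 0 < ((2 : ℝ) ^ n)⁻¹ := by positivity
    refine (h₁.trans h₂).trans_lt ?_
    linarith

/-- The space is the image of (0, T₁] × Y under (t, y) ↦ f_t y, Lipschitz in time by bounded speed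
and in space by `hC`. Separability permits testing density on countably many points. -/
theorem separableSpace_of_sweep {X : Type*} [MetricSpace X] {f : ℝ≥0 → X → X}
    (hspeed : HasBoundedSpeed f) {Y : Set X} [SecondCountableTopology Y]
    {T₁ : ℝ≥0} (hsweep : (⋃ (t : ℝ≥0) (_ : 0 < t ∧ t ≤ T₁), f t '' Y) = Set.univ)
    {C : ℝ≥0} (hC : ∀ t, 0 < t → t ≤ T₁ → LipschitzWith C fun y : Y => f t y) :
    TopologicalSpace.SeparableSpace X := by
  obtain ⟨K, hK, hspeed⟩ := hspeed
  have hlip : LipschitzWith (K.toNNReal + C)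
      (Function.uncurry fun (t : {t : ℝ≥0 // 0 < t ∧ t ≤ T₁}) (y : Y) => f t y) := by
    refine LipschitzWith.uncurry (fun y => LipschitzWith.of_dist_le_mul fun s t => ?_)
      fun t => hC t t.2.1 t.2.2
    rw [Real.coe_toNNReal K hK.le]
    exact dist_flow_le hspeed _ _ _
  refine Function.Surjective.denseRange ?_ |>.separableSpace hlip.continuous
  intro x
  have : x ∈ ⋃ (t : ℝ≥0) (_ : 0 < t ∧ t ≤ T₁), f t '' Y := hsweep ▸ Set.mem_univ x
  simp only [Set.mem_iUnion] at this
  obtain ⟨t, ht, z, hz, rfl⟩ := this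
  exact ⟨(⟨t, ht⟩, ⟨z, hz⟩), rfl⟩

/-- A measurable set whose complement is missed by almost every orbit arc between returns to the
section has full measure. -/
theorem IsInducedMeasure.ae_mem {X : Type*} [MeasurableSpace X] {f : ℝ≥0 → X → X} {ν : Measure X}
    {Y : Set X} (hY : IsPoincareSection f Y) {μ : Measure Y} [IsProbabilityMeasure μ]
    (hμ : IsInducedMeasure f ν Y μ) {S : Set X} (hS : MeasurableSet S)
    (h : ∀ᵐ y : Y ∂μ, ∀ t < hittingTime f Y y, f t y ∈ S) : ∀ᵐ x ∂ν, x ∈ S := by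
  -- Return times are positive, so the normalising factor of the decomposition can be cancelled.
  have hint : 0 < ∫ y : Y, (hittingTime f Y y : ℝ) ∂μ := by
    rw [integral_pos_iff_support_of_nonneg (fun y => NNReal.coe_nonneg _) hμ.integrable]
    have : Function.support (fun y : Y => (hittingTime f Y y : ℝ)) = Set.univ :=
      Set.eq_univ_of_forall fun y => (NNReal.coe_pos.2 (hY y y.2).1).ne'
    rw [this, measure_univ]
    exact one_pos
  have hdec := hμ.decomposition Sᶜ hS.compl
  have hzero : (∫⁻ y : Y, (∫⁻ t in Set.Ico (0 : ℝ) (hittingTime f Y y),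
      Sᶜ.indicator (fun _ => (1 : ℝ≥0∞)) (f t.toNNReal y)) ∂μ) = 0 := by
    refine (lintegral_congr_ae (g := fun _ => 0) ?_).trans lintegral_zero
    filter_upwards [h] with y hy
    refine setLIntegral_eq_zero measurableSet_Ico fun t ht => ?_
    refine Set.indicator_of_notMem (Set.notMem_compl_iff.2 (hy _ ?_)) _
    rw [Real.toNNReal_lt_iff_lt_coe ht.1]
    exact ht.2
  rw [hzero, mul_eq_zero] at hdec
  rcases hdec with h0 | h0
  · exact absurd (ENNReal.ofReal_eq_zero.1 h0) (not_le.2 hint)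
  · exact h0

variable {X : Type*} [MetricSpace X] [MeasurableSpace X] [BorelSpace X]
  {f : ℝ≥0 → X → X} {ν : Measure X} {Y : Set X} {μ : Measure Y} [IsProbabilityMeasure μ]
  {A : Type*} [Countable A] [MeasurableSpace A] [DiscreteMeasurableSpace A]
  {P : A → Set ℝ} {g : ℝ → ℝ} {ι : Y → ℝ} {T₁ : ℝ≥0}

/-- A point f_t y on an arc reaches F(y) after time R - t, and by invariance F(y) is typical for
almost every `y`. The finite delay does not affect the exponent. -/
theorem ae_limsup_le_of_upperMinkowskiDim_lt (hf : IsSemiflow f)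
    (hmeas : ∀ t, Measurable (f t)) (hY : IsPoincareSection f Y) (hμ : IsInducedMeasure f ν Y μ)
    (H : IsGibbsMarkov (poincareMap f Y hY) μ P g ι) (hspeed : HasBoundedSpeed f)
    (hsweep : (⋃ (t : ℝ≥0) (_ : 0 < t ∧ t ≤ T₁), f t '' Y) = Set.univ)
    (hdist : distortion f Y ι T₁ < ⊤) {b : ℝ} (hb : upperMinkowskiDim μ < b) :
    ∀ᵐ x ∂ν, limsup (fun r : ℝ => ENNReal.log (flowCoverTime f r x) /
      ((-Real.log r : ℝ) : EReal)) (𝓝[>] 0) ≤ b := by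
  obtain ⟨L, hL, hL'⟩ := H.biLipschitz
  obtain ⟨C, hC⟩ := exists_lipschitzWith_of_distortion hL hL' hdist
  have := H.secondCountable
  have := separableSpace_of_sweep hspeed hsweep hC
  have : Nonempty X := by
    obtain ⟨y⟩ : Nonempty Y := nonempty_of_isProbabilityMeasure μ
    exact ⟨y⟩
  obtain ⟨K, hK, hspeed⟩ := hspeed
  obtain ⟨b₁, hb₁, hb₁b⟩ : ∃ b₁ : ℝ, upperMinkowskiDim μ < b₁ ∧ b₁ < b := by
    obtain ⟨β, h₁, h₂⟩ := EReal.lt_iff_exists_real_btwn.1 hb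
    exact ⟨β, h₁, EReal.coe_lt_coe_iff.1 h₂⟩
  have hb₁0 : 0 < b₁ := EReal.coe_pos.1 (H.upperMinkowskiDim_nonneg.trans_lt hb₁)
  obtain ⟨b₂, hb₁₂, hb₂b⟩ := exists_between hb₁b
  set c : ℝ := 4 * (C + 1) with hc
  have hc0 : 0 < c := by positivity
  -- Countably many times and centres make these sets measurable although the maps f_t are only
  -- measurable.
  set S : ℕ → Set X := fun n => {x | ∀ i, ∃ j,
    (TopologicalSpace.denseSeq ℝ≥0 j : ℝ) ≤ ((2 : ℝ) ^ b₂) ^ n ∧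
      dist (f (TopologicalSpace.denseSeq ℝ≥0 j) x) (TopologicalSpace.denseSeq X i) <
        c * ((2 : ℝ) ^ n)⁻¹} with hS
  have hSmeas : ∀ n, MeasurableSet (S n) := by
    intro n
    have : S n = ⋂ i, ⋃ j, ⋃ (_ : (TopologicalSpace.denseSeq ℝ≥0 j : ℝ) ≤ ((2 : ℝ) ^ b₂) ^ n),
        f (TopologicalSpace.denseSeq ℝ≥0 j) ⁻¹'
          Metric.ball (TopologicalSpace.denseSeq X i) (c * ((2 : ℝ) ^ n)⁻¹) := by
      ext x
      simp [hS, Metric.mem_ball]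
    rw [this]
    exact MeasurableSet.iInter fun i => MeasurableSet.iUnion fun j => MeasurableSet.iUnion
      fun _ => hmeas _ Metric.isOpen_ball.measurableSet
  have hgood : ∀ᵐ x ∂ν, x ∈ liminf S atTop := by
    refine hμ.ae_mem hY (MeasurableSet.measurableSet_liminf hSmeas) ?_
    filter_upwards [H.measurePreserving.quasiMeasurePreserving.ae
      (ae_section_orbit_dense hf hY hμ.integrable H hsweep hC hb₁)] with y hy t ht
    rw [mem_liminf_iff_eventually_mem]
    filter_upwards [hy, eventually_add_le_pow (1 + hittingTime f Y y)
      (Real.one_lt_rpow one_lt_two hb₁0)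
      (Real.rpow_lt_rpow_of_exponent_lt one_lt_two hb₁₂)] with n hn hn' i
    obtain ⟨s, hs, hd⟩ := hn (TopologicalSpace.denseSeq X i)
    set R := hittingTime f Y y with hR
    have hsplit : f s (poincareMap f Y hY y) = f (s + (R - t)) (f t y) := by
      rw [← hf.add, add_assoc, tsub_add_cancel_of_le ht.le, hf.add]
      rfl
    rw [hsplit] at hd
    set s' := s + (R - t) with hs'
    -- The strict inequality at time s' persists for a short time by bounded speed, so a time of the
    -- dense sequence can be used; the cap 1 keeps the additional time bounded.
    set δ : ℝ≥0 := min 1 ((c * ((2 : ℝ) ^ n)⁻¹ -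
      dist (f s' (f t y)) (TopologicalSpace.denseSeq X i)) / K).toNNReal with hδ
    have hδ0 : 0 < δ := lt_min one_pos (Real.toNNReal_pos.2 (div_pos (sub_pos.2 hd) hK))
    obtain ⟨_, ⟨h₁, h₂⟩, j, rfl⟩ := (TopologicalSpace.denseRange_denseSeq ℝ≥0).inter_open_nonempty
      (Set.Ioo s' (s' + δ)) isOpen_Ioo (Set.nonempty_Ioo.2 (lt_add_of_pos_right _ hδ0))
    set d := TopologicalSpace.denseSeq ℝ≥0 j with hdj
    have h₁' : (s' : ℝ) < d := h₁
    have h₂' : (d : ℝ) < s' + δ := by exact_mod_cast h₂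
    have hδ1 : (δ : ℝ) ≤ 1 := by exact_mod_cast min_le_left _ _
    have hδ2 : (δ : ℝ) ≤ (c * ((2 : ℝ) ^ n)⁻¹ -
        dist (f s' (f t y)) (TopologicalSpace.denseSeq X i)) / K := by
      rw [← Real.coe_toNNReal _ (div_pos (sub_pos.2 hd) hK).le]
      exact NNReal.coe_le_coe.2 (min_le_right _ _)
    rw [le_div_iff₀ hK] at hδ2
    refine ⟨j, ?_, ?_⟩
    · have h₃ : (s' : ℝ) ≤ s + R := by
        exact_mod_cast add_le_add_right tsub_le_self s
      linarith
    · have h₃ := dist_flow_le hspeed (f t y) d s'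
      rw [NNReal.dist_eq, abs_of_pos (sub_pos.2 h₁')] at h₃
      have h₄ : K * ((d : ℝ) - s') < K * δ := by
        gcongr
        linarith
      have h₅ := dist_triangle (f d (f t y)) (f s' (f t y)) (TopologicalSpace.denseSeq X i)
      linarith
  filter_upwards [hgood] with x hx
  rw [mem_liminf_iff_eventually_mem] at hx
  -- The scale doubles to pass from the dense centres to all points.
  refine limsup_log_div_le (flowCoverTime_antitone x) (hb₁0.trans hb₁₂).le hb₂b
    (show 0 < 2 * c by positivity) ?_
  filter_upwards [hx] with n hn
  refine iInf₂_le _ ⟨Real.toNNReal_pos.2 (by positivity), fun z _ => ?_⟩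
  obtain ⟨_, hi, i, rfl⟩ := (TopologicalSpace.denseRange_denseSeq X).inter_open_nonempty
    (Metric.ball z (c * ((2 : ℝ) ^ n)⁻¹)) Metric.isOpen_ball
    ⟨z, Metric.mem_ball_self (by positivity)⟩
  obtain ⟨j, hj, hd⟩ := hn i
  refine ⟨_, NNReal.le_toNNReal_of_coe_le hj, ?_⟩
  have := dist_triangle (f (TopologicalSpace.denseSeq ℝ≥0 j) x) (TopologicalSpace.denseSeq X i) z
  rw [Metric.mem_ball] at hi
  linarith

/-- Almost surely the growth rate of the cover time is at most the upper Minkowski dimension of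
the measure on the section. -/
theorem ae_limsup_le_upperMinkowskiDim (hf : IsSemiflow f)
    (hmeas : ∀ t, Measurable (f t)) (hY : IsPoincareSection f Y) (hμ : IsInducedMeasure f ν Y μ)
    (H : IsGibbsMarkov (poincareMap f Y hY) μ P g ι) (hspeed : HasBoundedSpeed f)
    (hsweep : (⋃ (t : ℝ≥0) (_ : 0 < t ∧ t ≤ T₁), f t '' Y) = Set.univ)
    (hdist : distortion f Y ι T₁ < ⊤) :
    ∀ᵐ x ∂ν, limsup (fun r : ℝ => ENNReal.log (flowCoverTime f r x) /
      ((-Real.log r : ℝ) : EReal)) (𝓝[>] 0) ≤ upperMinkowskiDim μ := by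
  have hall : ∀ᵐ x ∂ν, ∀ b : ℚ, upperMinkowskiDim μ < ((b : ℝ) : EReal) →
      limsup (fun r : ℝ => ENNReal.log (flowCoverTime f r x) /
        ((-Real.log r : ℝ) : EReal)) (𝓝[>] 0) ≤ ((b : ℝ) : EReal) := by
    rw [ae_all_iff]
    intro b
    by_cases hb : upperMinkowskiDim μ < ((b : ℝ) : EReal)
    · filter_upwards [ae_limsup_le_of_upperMinkowskiDim_lt hf hmeas hY hμ H hspeed hsweep hdist hb]
        with x hx _ using hx
    · exact Eventually.of_forall fun x h => absurd h hb
  filter_upwards [hall] with x hx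
  by_contra! hlt
  obtain ⟨b, h₁, h₂⟩ := EReal.lt_iff_exists_rat_btwn.1 hlt
  exact absurd (hx b h₁) (not_le.2 h₂)

end UpperBound

end CoverTime

end

theorem theorem6p1 {X : Type*} [MetricSpace X] [MeasurableSpace X] [BorelSpace X]
    (f : ℝ≥0 → X → X) (hf : CoverTime.IsSemiflow f)
    (ν : Measure X) [IsProbabilityMeasure ν]
    (hinv : ∀ t, MeasurePreserving (f t) ν ν) (herg : CoverTime.IsErgodicFlow f ν)
    (Y : Set X) (hY : CoverTime.IsPoincareSection f Y)
    (μ : Measure Y) [IsProbabilityMeasure μ] (hμ : CoverTime.IsInducedMeasure f ν Y μ)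
    -- the Minkowski dimension of the induced measure exists and is finite
    (H1 : CoverTime.lowerMinkowskiDim μ = CoverTime.upperMinkowskiDim μ ∧
      CoverTime.upperMinkowskiDim μ < ⊤)
    -- the Poincaré map is Gibbs–Markov
    {A : Type*} [Countable A] [MeasurableSpace A] [DiscreteMeasurableSpace A]
    (P : A → Set ℝ) (g : ℝ → ℝ) (ι : Y → ℝ)
    (H2 : CoverTime.IsGibbsMarkov (CoverTime.poincareMap f Y hY) μ P g ι)
    -- bounded speed
    (H3 : CoverTime.HasBoundedSpeed f)
    -- topological mixing, and the section sweeps out the space in a uniform time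
    (T₁ : ℝ≥0) (hT₁ : 0 < T₁)
    (H4 : CoverTime.IsTopologicallyMixing f ∧
      (⋃ (t : ℝ≥0) (_ : 0 < t ∧ t ≤ T₁), f t '' Y) = Set.univ)
    -- bounded distortion
    (H5 : 0 < CoverTime.distortion f Y ι T₁ ∧ CoverTime.distortion f Y ι T₁ < ⊤) :
    (∀ᵐ x ∂ν, CoverTime.lowerMinkowskiDim ν - 1 ≤
      liminf (fun r : ℝ => ENNReal.log (CoverTime.flowCoverTime f r x) /
        ((-Real.log r : ℝ) : EReal)) (𝓝[>] 0)) ∧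
    (CoverTime.upperMinkowskiDim ν = CoverTime.upperMinkowskiDim μ + 1 →
      ∀ᵐ x ∂ν, limsup (fun r : ℝ => ENNReal.log (CoverTime.flowCoverTime f r x) /
        ((-Real.log r : ℝ) : EReal)) (𝓝[>] 0) ≤ CoverTime.upperMinkowskiDim μ) := by
  have hΩ := CoverTime.nonwanderingSet_eq_univ H4.1
  have := CoverTime.nontrivial_of_distortion_pos H5.1
  exact ⟨CoverTime.ae_lowerMinkowskiDim_sub_one_le hinv H3 hΩ, fun _ =>
    CoverTime.ae_limsup_le_upperMinkowskiDim hf (fun t => (hinv t).measurable) hY hμ H2 H3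
      H4.2 H5.2⟩
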